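/- Let $k\ge 1$ and let $\Lambda$ be a finite $k$-graph with no sources: a countable small category with a degree functor $d:\Lambda\to\mathbb N^k$ such that every morphism (path) $\lambda$ with $d(\lambda)=m+n$ factors uniquely as $\lambda=\mu\nu$ with $d(\mu)=m$, $d(\nu)=n$; every $\Lambda^n=d^{-1}(n)$ is finite; and for all vertices $v$ and all $n\in\mathbb N^k$ the set $v\Lambda^n$ of paths of degree $n$ with range $v$ is nonempty. Write $r,s$ for range and source, $\Lambda^0$ for the set of vertices, and $e_1,\dots,e_k$ for the standard basis of $\mathbb N^k$; the elements of the sets $\Lambda^{e_i}$ are called edges. Let $C^*(\Lambda)$ be the universal $C^*$-algebra generated by a Cuntz--Krieger $\Lambda$-family, that is, by partial isometries $\{t_\lambda\}_{\lambda\in\Lambda}$ such that $\{t_v\}_{v\in\Lambda^0}$ are mutually orthogonal projections, $t_\lambda t_\eta=t_{\lambda\eta}$ if $s(\lambda)=r(\eta)$, $t_\lambda^*t_\lambda=t_{s(\lambda)}$, and $t_v=\sum_{\lambda\in v\Lambda^n}t_\lambda t_\lambda^*$ for all $v\in\Lambda^0$, $n\in\mathbb N^k$. Let $(X,\mathcal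 F,\mu)$ be a measure space. For each $1\le i\le k$ let $\{\tau_f:D_f\to R_f\}_{f\in\Lambda^{e_i}}$ be a semibranching function system on $(X,\mu)$ with coding map $\tau^{e_i}:X\to X$. This means: the $D_f\subset X$ are measurable, the maps $\tau_f:D_f\to X$ are measurable with range $R_f=\tau_f(D_f)$, and they map measurable sets to measurable sets; $\mu(X\setminus\bigcup_{f\in\Lambda^{e_i}}R_f)=0$ and $\mu(R_f\cap R_g)=0$ for $f\ne g$ in $\Lambda^{e_i}$; the measure $\mu\circ\tau_f$ on $D_f$ has a (finite-valued, measurable) Radon--Nikodym derivative $\Phi_{\tau_f}=\frac{d(\mu\circ\tau_f)}{d\mu}$ with $\Phi_{\tau_f}>0$ $\mu$-a.e. on $D_f$; and $\tau^{e_i}$ is measurable with $\tau^{e_i}(\tau_f(x))=x$ for all $x\in D_f$. Suppose that there are sets $D_v\subset X$, $v\in\Lambda^0$, such that: (i) $D_f=D_{s(f)}$ for every edge $f$, and $\mu(D_v)>0$ for every $v\in\Lambda^0$; (ii) $\mu(D_v\cap D_w)=0$ for $v\ne w$ in $\Lambda^0$; (iii) for all $i,j\in\{1,\dots,k\}$,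 if $\lambda\alpha=\nu\beta$ with $\lambda,\beta\in\Lambda^{e_i}$ and $\nu,\alpha\in\Lambda^{e_j}$, then $R_\alpha\subset D_\lambda$, $R_\beta\subset D_\nu$ and $\tau_\lambda\circ\tau_\alpha=\tau_\nu\circ\tau_\beta$; (iv) $\tau^{e_i}\circ\tau^{e_j}=\tau^{e_j}\circ\tau^{e_i}$ for all $i,j$; (v) $\mu\bigl(D_v\setminus\bigcup_{g\in v\Lambda^{e_i}}R_g\bigr)=0$ for all $v\in\Lambda^0$ and $1\le i\le k$. Then for each $1\le i\le k$ and $f\in\Lambda^{e_i}$ the formula $$S_f\xi(x)=\chi_{R_f}(x)\,\bigl(\Phi_{\tau_f}(\tau^{e_i}(x))\bigr)^{-1/2}\,\xi(\tau^{e_i}(x))$$ defines a bounded operator $S_f\in B(L^2(X,\mu))$, and the operators $\{S_f: f\in\Lambda^{e_i},\,1\le i\le k\}$ generate a representation of $C^*(\Lambda)$ on $L^2(X,\mu)$: there is a unique $*$-homomorphism $\pi:C^*(\Lambda)\to B(L^2(X,\mu))$ with $\pi(t_f)=S_f$ for every edge $f$, and the closure of $\pi(C^*(\Lambda))$ is the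 $C^*$-algebra generated by the operators $S_f$. -/

import Mathlib

open CategoryTheory MeasureTheory
open scoped ENNReal

universe u v w

noncomputable section

/-! ### Higher-rank graphs

A morphism `f : a ⟶ b` of the category is a path with source `s(f) = a` and range `r(f) = b`, so
the path written `f g` (with `s(f) = r(g)`) in the graph literature is `g ≫ f` here.
`Arrow Λ` is the set of all paths; for `f : Arrow Λ`, the source is `f.left`, the range `f.right`. -/

/-- A `k`-graph: a countable small category with a degree functor to `ℕ^k` that satisfies the
factorization property. -/
structure HigherRankGraph (k : ℕ) (Λ : Type u) [Category.{v} Λ] where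
  /-- the degree of a path -/
  deg : Arrow Λ → Fin k → ℕ
  countable : Countable (Arrow Λ)
  deg_id : ∀ a : Λ, deg (Arrow.mk (𝟙 a)) = 0
  deg_comp : ∀ {a b c : Λ} (g : a ⟶ b) (f : b ⟶ c),
    deg (Arrow.mk (g ≫ f)) = deg (Arrow.mk f) + deg (Arrow.mk g)
  factorization : ∀ {a c : Λ} (h : a ⟶ c) (m n : Fin k → ℕ), deg (Arrow.mk h) = m + n →
    ∃! p : Σ b : Λ, (a ⟶ b) × (b ⟶ c),
      p.2.1 ≫ p.2.2 = h ∧ deg (Arrow.mk p.2.2) = m ∧ deg (Arrow.mk p.2.1) = n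

namespace HigherRankGraph

variable {k : ℕ} {Λ : Type u} [Category.{v} Λ]

/-- The standard basis vector `e_i` of `ℕ^k`. -/
def basisVec (i : Fin k) : Fin k → ℕ := Pi.single i 1

/-- `Λ^n`, the set of paths of degree `n`. -/
def pathsOfDeg (G : HigherRankGraph k Λ) (n : Fin k → ℕ) : Set (Arrow Λ) := {f | G.deg f = n}

/-- `aΛ^n`, the set of paths of degree `n` with range `a`. -/
def pathsInto (G : HigherRankGraph k Λ) (a : Λ) (n : Fin k → ℕ) : Set (Arrow Λ) :=
  {f | f.right = a ∧ G.deg f = n}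

/-- `Λ^{e_i}`, the edges of colour `i`. -/
abbrev Edge (G : HigherRankGraph k Λ) (i : Fin k) : Type (max u v) := G.pathsOfDeg (basisVec i)

/-- `Λ` is finite: every `Λ^n` is a finite set. -/
def IsFinite (G : HigherRankGraph k Λ) : Prop := ∀ n : Fin k → ℕ, (G.pathsOfDeg n).Finite

/-- `Λ` has no sources: every `aΛ^n` is nonempty. -/
def NoSources (G : HigherRankGraph k Λ) : Prop :=
  ∀ (a : Λ) (n : Fin k → ℕ), (G.pathsInto a n).Nonempty

/-! ### Cuntz–Krieger families and `C*(Λ)` -/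

/-- Cuntz–Krieger `Λ`-families in a C*-algebra, for a row-finite `Λ` (so that the sum in `ck4` is
a finite sum). -/
structure IsCKFamily (G : HigherRankGraph k Λ) {A : Type w} [NonUnitalCStarAlgebra A]
    (t : Arrow Λ → A) : Prop where
  partialIsometry : ∀ f, t f * star (t f) * t f = t f
  ck1_proj : ∀ a : Λ, IsStarProjection (t (Arrow.mk (𝟙 a)))
  ck1_orth : ∀ a b : Λ, a ≠ b → t (Arrow.mk (𝟙 a)) * t (Arrow.mk (𝟙 b)) = 0
  ck2 : ∀ {a b c : Λ} (g : a ⟶ b) (f : b ⟶ c),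
    t (Arrow.mk f) * t (Arrow.mk g) = t (Arrow.mk (g ≫ f))
  ck3 : ∀ {a b : Λ} (f : a ⟶ b), star (t (Arrow.mk f)) * t (Arrow.mk f) = t (Arrow.mk (𝟙 a))
  ck4 : ∀ (a : Λ) (n : Fin k → ℕ),
    t (Arrow.mk (𝟙 a)) = ∑ᶠ f ∈ G.pathsInto a n, t f * star (t f)

/-- A C*-algebra (in the universe `w`) together with a Cuntz–Krieger `Λ`-family in it. -/
structure CKPair (G : HigherRankGraph k Λ) where
  /-- the C*-algebra -/
  alg : Type w
  [cstar : NonUnitalCStarAlgebra alg]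
  /-- the family -/
  fam : Arrow Λ → alg
  isCK : G.IsCKFamily fam

attribute [instance] CKPair.cstar

theorem norm_le_one_of_partialIsometry {A : Type w} [NonUnitalCStarAlgebra A] {x : A}
    (hx : x * star x * x = x) : ‖x‖ ≤ 1 := by
  have h1 : ‖x * star x‖ * ‖x * star x‖ = ‖x * star x‖ := by
    have h2 : (x * star x) * star (x * star x) = x * star x := by
      rw [star_mul, star_star, ← mul_assoc, hx]
    rw [← CStarRing.norm_self_mul_star (x := x * star x), h2]
  rw [CStarRing.norm_self_mul_star] at h1
  by_contra! h
  nlinarith [mul_pos (sub_pos.mpr h) (lt_trans one_pos h),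
    mul_pos (lt_trans one_pos h) (lt_trans one_pos h)]

/-- The universal family: the tuple of all Cuntz–Krieger families, in the `ℓ^∞`-product of all the
C*-algebras that carry one. -/
def universalFamily (G : HigherRankGraph k Λ) (f : Arrow Λ) :
    lp (fun P : CKPair.{u, v, w} G => P.alg) ∞ :=
  ⟨fun P => P.fam f, memℓp_infty ⟨1, by
    rintro _ ⟨P, rfl⟩
    exact norm_le_one_of_partialIsometry (P.isCK.partialIsometry f)⟩⟩

/-- `C*(Λ)`, the universal C*-algebra generated by a Cuntz–Krieger `Λ`-family: the C*-algebra
generated by the universal family. It maps onto the C*-algebra generated by any Cuntz–Krieger family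
in any C*-algebra of `Type w`, by evaluation at the corresponding coordinate. (The algebra generated
by a Cuntz–Krieger family of a countable `Λ` is separable, so up to isomorphism the result does not
depend on `w`.) -/
def cstarSubalgebra (G : HigherRankGraph k Λ) :
    NonUnitalStarSubalgebra ℂ (lp (fun P : CKPair.{u, v, w} G => P.alg) ∞) :=
  (NonUnitalStarAlgebra.adjoin ℂ (Set.range G.universalFamily)).topologicalClosure

/-- `C*(Λ)` as a type. -/
abbrev CStarAlg (G : HigherRankGraph k Λ) : Type (max u v (w + 1)) :=
  cstarSubalgebra.{u, v, w} G

instance isClosed_cstarSubalgebra (G : HigherRankGraph k Λ) :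
    IsClosed (cstarSubalgebra.{u, v, w} G : Set (lp (fun P : CKPair.{u, v, w} G => P.alg) ∞)) :=
  NonUnitalStarSubalgebra.isClosed_topologicalClosure _

/-- The generator `t_f` of `C*(Λ)`. -/
def gen (G : HigherRankGraph k Λ) (f : Arrow Λ) : CStarAlg.{u, v, w} G :=
  ⟨G.universalFamily f, NonUnitalStarSubalgebra.le_topologicalClosure _
    (NonUnitalStarAlgebra.subset_adjoin ℂ _ ⟨f, rfl⟩)⟩

end HigherRankGraph

/-! ### Semibranching function systems

A partial map `σ_j : D_j → X` is given by a function `σ j : X → X` whose values off `D j` play no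
role; its range is `R_j = σ j '' D j`. -/

/-- `Φ` is a Radon–Nikodym derivative `d(μ ∘ σ)/dμ` on `D`, where `(μ ∘ σ)(E) = μ(σ(E))` for
measurable `E ⊆ D`. It is finite-valued; no σ-finiteness is required. -/
structure IsRNDerivOn {X : Type u} [MeasurableSpace X] (μ : Measure X) (D : Set X) (σ : X → X)
    (Φ : X → ℝ) : Prop where
  measurable : Measurable Φ
  nonneg : ∀ x ∈ D, 0 ≤ Φ x
  measurableSet_image : ∀ E ⊆ D, MeasurableSet E → MeasurableSet (σ '' E)
  measure_image : ∀ E ⊆ D, MeasurableSet E → μ (σ '' E) = ∫⁻ x in E, ENNReal.ofReal (Φ x) ∂μ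

/-- The maps `σ_j : D_j → X` form a semibranching function system on `(X, μ)`, with Radon–Nikodym
derivatives `Φ_j`. -/
structure IsSemibranching {X : Type u} [MeasurableSpace X] (μ : Measure X) {ι : Type v}
    (D : ι → Set X) (σ : ι → X → X) (Φ : ι → X → ℝ) : Prop where
  measurableSet_dom : ∀ j, MeasurableSet (D j)
  measurable_map : ∀ j, Measurable ((D j).domRestrict (σ j))
  cover : μ (⋃ j, σ j '' D j)ᶜ = 0
  disjoint : ∀ j l, j ≠ l → μ (σ j '' D j ∩ σ l '' D l) = 0
  rnDeriv : ∀ j, IsRNDerivOn μ (D j) (σ j) (Φ j)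
  rnDeriv_pos : ∀ j, ∀ᵐ x ∂μ, x ∈ D j → 0 < Φ j x

/-- `c : X → X` is a coding map for the family `σ_j : D_j → X`. -/
structure IsCodingMap {X : Type u} [MeasurableSpace X] {ι : Type v}
    (D : ι → Set X) (σ : ι → X → X) (c : X → X) : Prop where
  measurable : Measurable c
  apply_map : ∀ j, ∀ x ∈ D j, c (σ j x) = x

/-- For every colour `i`, the maps `τ_f : D_f → X`, `f ∈ Λ^{e_i}`, form a semibranching function
system with coding map `c i = τ^{e_i}`, and together they satisfy the compatibility conditions
(i)–(v). The set `DV a` is `D_a` for the vertex `a`. -/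
structure IsEdgeSemibranching {k : ℕ} {Λ : Type u} [Category.{v} Λ] (G : HigherRankGraph k Λ)
    {X : Type w} [MeasurableSpace X] (μ : Measure X)
    (D : ∀ i, G.Edge i → Set X) (τ : ∀ i, G.Edge i → X → X) (Φ : ∀ i, G.Edge i → X → ℝ)
    (c : Fin k → X → X) (DV : Λ → Set X) : Prop where
  semibranching : ∀ i, IsSemibranching μ (D i) (τ i) (Φ i)
  coding : ∀ i, IsCodingMap (D i) (τ i) (c i)
  /-- (i), first part: `D_f` only depends on the source of the edge `f`. -/
  cond_i_dom : ∀ i (f : G.Edge i), D i f = DV f.1.left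
  /-- (i), second part. -/
  cond_i_pos : ∀ a, 0 < μ (DV a)
  cond_ii : ∀ a b, a ≠ b → μ (DV a ∩ DV b) = 0
  /-- (iii): here `lam α = ν β` as paths, where `lam, β` have colour `i` and `ν, α` colour `j`. -/
  cond_iii : ∀ (i j : Fin k) {a b b' d : Λ} (lam : b ⟶ d) (α : a ⟶ b) (ν : b' ⟶ d) (β : a ⟶ b')
    (hlam : Arrow.mk lam ∈ G.pathsOfDeg (HigherRankGraph.basisVec i))
    (hα : Arrow.mk α ∈ G.pathsOfDeg (HigherRankGraph.basisVec j))
    (hν : Arrow.mk ν ∈ G.pathsOfDeg (HigherRankGraph.basisVec j))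
    (hβ : Arrow.mk β ∈ G.pathsOfDeg (HigherRankGraph.basisVec i)),
    α ≫ lam = β ≫ ν →
      τ j ⟨_, hα⟩ '' D j ⟨_, hα⟩ ⊆ D i ⟨_, hlam⟩ ∧
      τ i ⟨_, hβ⟩ '' D i ⟨_, hβ⟩ ⊆ D j ⟨_, hν⟩ ∧
      ∀ x ∈ D j ⟨_, hα⟩, τ i ⟨_, hlam⟩ (τ j ⟨_, hα⟩ x) = τ j ⟨_, hν⟩ (τ i ⟨_, hβ⟩ x)
  cond_iv : ∀ i j, c i ∘ c j = c j ∘ c i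
  cond_v : ∀ (a : Λ) (i : Fin k),
    μ (DV a \ ⋃ g : {g : G.Edge i // g.1.right = a}, τ i g.1 '' D i g.1) = 0

end

/-! The operator `S_f` is composition with the coding map on `R_f`, and its weight is the one that
makes it isometric. Since `μ ∘ τ_f` has density `Φ` on `D_f`, the coding map carries `μ` on `R_f` to
`Φ μ` on `D_f`, and the factor `Φ^(-1/2)` cancels this density in the `L²`-norm. Hence `S_f` is a
partial isometry with `S_f* S_f = χ_{D_f}` and `S_f S_f* = χ_{R_f}` (`IsBranch.star_mul_self`,
`IsBranch.mul_star_self`).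

The geometry of the sets then becomes operator relations (`IsEdgeSemibranching.isEdgeFamily`).
Almost disjoint ranges within a colour give `S_f* S_g = 0` for `f ≠ g`. Conditions (i), (iii) and
(v) say that, up to a null set, `D_f` is the union of the `R_g` over edges `g` of any fixed colour
with range `s(f)`, so `S_f* S_f = ∑ S_g S_g*`. The two sides of a commuting square are weighted
compositions with the same map and the same left inverse, by (iii) and (iv), so they agree
(`IsBranch.operator_mul_comm`).

The rest is algebra. Edge operators with these relations extend to a Cuntz–Krieger family
(`IsEdgeFamily.isCKFamily`): a path goes to the product over a factorization into edges, and the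
commuting squares make the product independent of the factorization. A vertex goes to the sum of the
range projections of the edges of one colour that end there, and the relations force this sum to be
the same for all colours. The representation is then evaluation at a coordinate of the universal
family. Its uniqueness and its range follow because the edge generators alone generate a dense
*-subalgebra. -/

namespace HigherRankGraph

/-! ### Composition and unique factorization of paths. -/

section Paths

variable {k : ℕ} {Λ : Type u} [Category.{v} Λ]

theorem exists_eq_mk (p : Arrow Λ) : ∃ (a b : Λ) (f : a ⟶ b), p = Arrow.mk f :=
  ⟨_, _, p.hom, rfl⟩

open Classical in
/-- The composite `p q` of two paths with `s(p) = r(q)`; it is `p` if they do not compose. -/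
noncomputable def pathComp (p q : Arrow Λ) : Arrow Λ :=
  if h : q.right = p.left then Arrow.mk (q.hom ≫ eqToHom h ≫ p.hom) else p

theorem pathComp_mk {a b c : Λ} (f : b ⟶ c) (g : a ⟶ b) :
    pathComp (Arrow.mk f) (Arrow.mk g) = Arrow.mk (g ≫ f) := by
  simp [pathComp]

theorem pathComp_left {p q : Arrow Λ} (h : q.right = p.left) : (pathComp p q).left = q.left := by
  simp [pathComp, h]

theorem pathComp_right {p q : Arrow Λ} (h : q.right = p.left) :
    (pathComp p q).right = p.right := by
  simp [pathComp, h]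

theorem pathComp_assoc {p q r : Arrow Λ} (h : q.right = p.left) (h' : r.right = q.left) :
    pathComp (pathComp p q) r = pathComp p (pathComp q r) := by
  obtain ⟨b, c, f, rfl⟩ := exists_eq_mk p
  obtain ⟨b', c', g, rfl⟩ := exists_eq_mk q
  obtain ⟨a, a', e, rfl⟩ := exists_eq_mk r
  obtain rfl : c' = b := h
  obtain rfl : a' = b' := h'
  simp only [pathComp_mk, Category.assoc]

theorem id_pathComp (p : Arrow Λ) : pathComp (Arrow.mk (𝟙 p.right)) p = p := by
  obtain ⟨b, c, f⟩ := p
  change pathComp (Arrow.mk (𝟙 c)) (Arrow.mk f) = Arrow.mk f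
  rw [pathComp_mk]
  exact congrArg Arrow.mk (Category.comp_id f)

theorem pathComp_id (p : Arrow Λ) : pathComp p (Arrow.mk (𝟙 p.left)) = p := by
  obtain ⟨b, c, f⟩ := p
  change pathComp (Arrow.mk f) (Arrow.mk (𝟙 b)) = Arrow.mk f
  rw [pathComp_mk]
  exact congrArg Arrow.mk (Category.id_comp f)

variable (G : HigherRankGraph k Λ)

theorem deg_pathComp {p q : Arrow Λ} (h : q.right = p.left) :
    G.deg (pathComp p q) = G.deg p + G.deg q := by
  obtain ⟨b, c, f, rfl⟩ := exists_eq_mk p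
  obtain ⟨a, b', g, rfl⟩ := exists_eq_mk q
  obtain rfl : b' = b := h
  rw [pathComp_mk, G.deg_comp]

theorem exists_pathComp {l : Arrow Λ} {m n : Fin k → ℕ} (h : G.deg l = m + n) :
    ∃ p q : Arrow Λ, q.right = p.left ∧ pathComp p q = l ∧ G.deg p = m ∧ G.deg q = n := by
  obtain ⟨a, c, f⟩ := l
  obtain ⟨⟨b, g, e⟩, ⟨h1, h2, h3⟩, -⟩ := G.factorization f m n h
  exact ⟨Arrow.mk e, Arrow.mk g, rfl, by rw [pathComp_mk]; exact congrArg Arrow.mk h1, h2, h3⟩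

theorem pathComp_inj {p q p' q' : Arrow Λ} (h : q.right = p.left) (h' : q'.right = p'.left)
    (hc : pathComp p q = pathComp p' q') (hp : G.deg p = G.deg p') : p = p' ∧ q = q' := by
  have hq : G.deg q = G.deg q' := by
    have := congrArg G.deg hc
    rw [G.deg_pathComp h, G.deg_pathComp h', hp] at this
    exact add_left_cancel this
  have hl := congrArg (fun x => x.left) hc
  have hr := congrArg (fun x => x.right) hc
  simp only [pathComp_left h, pathComp_left h', pathComp_right h, pathComp_right h'] at hl hr
  obtain ⟨b, c, f⟩ := p
  obtain ⟨a, b₁, g⟩ := q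
  obtain ⟨b', c', f'⟩ := p'
  obtain ⟨a', b₁', g'⟩ := q'
  dsimp at h h' hl hr f g f' g'
  subst h h' hl hr
  change pathComp (Arrow.mk f) (Arrow.mk g) = pathComp (Arrow.mk f') (Arrow.mk g') at hc
  rw [pathComp_mk, pathComp_mk, Arrow.mk_inj] at hc
  have := (G.factorization (g ≫ f) (G.deg (Arrow.mk f)) (G.deg (Arrow.mk g))
    (G.deg_comp g f)).unique (y₁ := ⟨_, g, f⟩) (y₂ := ⟨_, g', f'⟩) ⟨rfl, rfl, rfl⟩
    ⟨hc.symm, hp.symm, hq.symm⟩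
  cases this
  exact ⟨rfl, rfl⟩

theorem eq_id_of_deg_eq_zero {p : Arrow Λ} (h : G.deg p = 0) : p = Arrow.mk (𝟙 p.right) := by
  refine (G.pathComp_inj (q := Arrow.mk (𝟙 p.left)) (q' := p) rfl rfl
    ((pathComp_id p).trans (id_pathComp p).symm) ?_).1
  rw [h, G.deg_id]

variable {G}

theorem IsFinite.pathsInto (hfin : G.IsFinite) (a : Λ) (n : Fin k → ℕ) :
    (G.pathsInto a n).Finite :=
  (hfin n).subset fun _ h => h.2

/-- Unique factorization makes composition a bijection from composable pairs of degrees `m`, `n`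
onto paths of degree `m + n`. -/
theorem sum_pathsInto_add (hfin : G.IsFinite) {M : Type*} [AddCommMonoid M] (F : Arrow Λ → M)
    (a : Λ) (m n : Fin k → ℕ) :
    ∑ l ∈ (hfin.pathsInto a (m + n)).toFinset, F l =
      ∑ p ∈ (hfin.pathsInto a m).toFinset, ∑ q ∈ (hfin.pathsInto p.left n).toFinset,
        F (pathComp p q) := by
  rw [Finset.sum_sigma']
  symm
  refine Finset.sum_bij (fun x _ => pathComp x.1 x.2) ?_ ?_ ?_ (fun _ _ => rfl)
  · rintro ⟨p, q⟩ h
    simp only [Finset.mem_sigma, Set.Finite.mem_toFinset, HigherRankGraph.pathsInto,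
      Set.mem_ofPred_eq] at h ⊢
    rw [pathComp_right h.2.1, G.deg_pathComp h.2.1, h.1.2, h.2.2]
    exact ⟨h.1.1, rfl⟩
  · rintro ⟨p, q⟩ h ⟨p', q'⟩ h' he
    simp only [Finset.mem_sigma, Set.Finite.mem_toFinset, HigherRankGraph.pathsInto,
      Set.mem_ofPred_eq] at h h'
    obtain ⟨rfl, rfl⟩ := G.pathComp_inj h.2.1 h'.2.1 he (h.1.2.trans h'.1.2.symm)
    rfl
  · intro l hl
    simp only [Set.Finite.mem_toFinset, HigherRankGraph.pathsInto, Set.mem_ofPred_eq] at hl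
    obtain ⟨p, q, h, rfl, hp, hq⟩ := G.exists_pathComp hl.2
    refine ⟨⟨p, q⟩, ?_, rfl⟩
    rw [pathComp_right h] at hl
    simp only [Finset.mem_sigma, Set.Finite.mem_toFinset, HigherRankGraph.pathsInto,
      Set.mem_ofPred_eq]
    exact ⟨⟨hl.1, hp⟩, h, hq⟩

theorem sum_basisVec (i : Fin k) : ∑ j, basisVec i j = 1 := by
  simp [basisVec]

theorem basisVec_injective : Function.Injective (basisVec : Fin k → Fin k → ℕ) := by
  intro i j h
  by_contra hij
  have := congrFun h i
  simp [basisVec, hij] at this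

theorem exists_basisVec_add {n : Fin k → ℕ} {i : Fin k} (h : n i ≠ 0) :
    ∃ m, n = basisVec i + m := by
  refine ⟨n - basisVec i, funext fun j => ?_⟩
  by_cases hj : j = i
  · subst hj; simp [basisVec]; omega
  · simp [basisVec, hj]

theorem sum_eq_of_eq_basisVec_add {n m : Fin k → ℕ} {i : Fin k} {N : ℕ}
    (h : n = basisVec i + m) (hn : ∑ j, n j = N + 1) : ∑ j, m j = N := by
  subst h
  simp only [Pi.add_apply, Finset.sum_add_distrib, sum_basisVec] at hn
  omega

theorem eq_zero_of_sum_eq_zero {n : Fin k → ℕ} (h : ∑ j, n j = 0) : n = 0 := by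
  funext j
  simpa using (Finset.sum_eq_zero_iff.mp h) j (Finset.mem_univ j)

/-- A path of nonzero degree starts with an edge. -/
theorem exists_edge_pathComp {N : ℕ} {l : Arrow Λ} (h : ∑ j, G.deg l j = N + 1) :
    ∃ x : Arrow Λ × Arrow Λ, x.2.right = x.1.left ∧ pathComp x.1 x.2 = l ∧
      (∃ i, G.deg x.1 = basisVec i) ∧ ∑ j, G.deg x.2 j = N := by
  obtain ⟨i, -, hi⟩ : ∃ i ∈ Finset.univ, G.deg l i ≠ 0 :=
    Finset.exists_ne_zero_of_sum_ne_zero (by omega)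
  obtain ⟨m, hm⟩ := exists_basisVec_add hi
  obtain ⟨p, q, hpq, hc, hp, hq⟩ := G.exists_pathComp hm
  exact ⟨(p, q), hpq, hc, ⟨i, hp⟩, by rw [hq]; exact sum_eq_of_eq_basisVec_add hm h⟩

end Paths

end HigherRankGraph

namespace HigherRankGraph

/-! ### From operators on edges to a Cuntz–Krieger family. -/

section EdgeFamily

variable {k : ℕ} {Λ : Type u} [Category.{v} Λ] {G : HigherRankGraph k Λ}
  {A : Type w} [NonUnitalCStarAlgebra A]

/-- Relations among elements indexed by the edges of a `k`-graph that allow to extend them to a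
Cuntz–Krieger family. -/
structure IsEdgeFamily (hfin : G.IsFinite) (S : Arrow Λ → A) : Prop where
  partialIsometry : ∀ i f, G.deg f = basisVec i → S f * star (S f) * S f = S f
  star_mul_self : ∀ i j f, G.deg f = basisVec i →
    star (S f) * S f = ∑ h ∈ (hfin.pathsInto f.left (basisVec j)).toFinset, S h * star (S h)
  star_mul_of_ne : ∀ i f g, G.deg f = basisVec i → G.deg g = basisVec i → f ≠ g →
    star (S f) * S g = 0
  commute : ∀ i j f g g' f', G.deg f = basisVec i → G.deg g = basisVec j →
    G.deg g' = basisVec j → G.deg f' = basisVec i → g.right = f.left → f'.right = g'.left →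
    pathComp f g = pathComp g' f' → S f * S g = S g' * S f'

/-- The sum of the range projections of the edges of colour `i` with range `a`. -/
noncomputable def vertexProj (hfin : G.IsFinite) (S : Arrow Λ → A) (i : Fin k) (a : Λ) : A :=
  ∑ h ∈ (hfin.pathsInto a (basisVec i)).toFinset, S h * star (S h)

open Classical in
/-- The extension of an edge family to paths of total degree `N`, by splitting off edges. -/
noncomputable def pathProd (hfin : G.IsFinite) (S : Arrow Λ → A) (i₀ : Fin k) : ℕ → Arrow Λ → A
  | 0, l => vertexProj hfin S i₀ l.right
  -- The first edge is an arbitrary choice; `IsEdgeFamily.pathProd_edge_mul` removes the dependence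
  -- on it. The value `0` is never met by `pathFamily`.
  | N + 1, l => if h : ∑ j, G.deg l j = N + 1 then
      S (exists_edge_pathComp h).choose.1 *
        pathProd hfin S i₀ N (exists_edge_pathComp h).choose.2 else 0

/-- The extension of an edge family to all paths. -/
noncomputable def pathFamily (hfin : G.IsFinite) (S : Arrow Λ → A) (i₀ : Fin k) (l : Arrow Λ) : A :=
  pathProd hfin S i₀ (∑ j, G.deg l j) l

variable {hfin : G.IsFinite} {S : Arrow Λ → A}

theorem pathProd_succ {i₀ : Fin k} {N : ℕ} {l : Arrow Λ} (h : ∑ j, G.deg l j = N + 1) :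
    pathProd hfin S i₀ (N + 1) l = S (exists_edge_pathComp h).choose.1 *
      pathProd hfin S i₀ N (exists_edge_pathComp h).choose.2 :=
  dif_pos h

/-- Well-definedness of the product: any first edge `f` may replace the chosen one. If the colours
agree, unique factorization gives equality; otherwise one commuting square exchanges the two edges,
and induction treats the shorter remainders. -/
theorem IsEdgeFamily.pathProd_edge_mul (hS : IsEdgeFamily hfin S) (i₀ : Fin k) (N : ℕ) :
    ∀ (j : Fin k) (f m : Arrow Λ), G.deg f = basisVec j → ∑ x, G.deg m x = N →
      m.right = f.left →
      pathProd hfin S i₀ (N + 1) (pathComp f m) = S f * pathProd hfin S i₀ N m := by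
  induction N with
  | zero =>
    intro j f m hf hm hfm
    have h : ∑ x, G.deg (pathComp f m) x = 0 + 1 := by
      simp only [G.deg_pathComp hfm, Pi.add_apply, Finset.sum_add_distrib, hm, hf, sum_basisVec]
    rw [pathProd_succ h]
    obtain ⟨h1, h2, ⟨i, h3⟩, h4⟩ := (exists_edge_pathComp h).choose_spec
    generalize (exists_edge_pathComp h).choose = x at *
    have hij : G.deg x.1 = G.deg f := by
      have := congrArg G.deg h2
      rwa [G.deg_pathComp h1, G.deg_pathComp hfm, eq_zero_of_sum_eq_zero h4,
        eq_zero_of_sum_eq_zero hm, add_zero, add_zero] at this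
    obtain ⟨e1, e2⟩ := G.pathComp_inj h1 hfm h2 hij
    rw [e1, e2]
  | succ N ih =>
    intro j f m hf hm hfm
    have h : ∑ x, G.deg (pathComp f m) x = N + 1 + 1 := by
      simp only [G.deg_pathComp hfm, Pi.add_apply, Finset.sum_add_distrib, hm, hf, sum_basisVec]
      omega
    rw [pathProd_succ h]
    obtain ⟨h1, h2, ⟨i, h3⟩, h4⟩ := (exists_edge_pathComp h).choose_spec
    generalize (exists_edge_pathComp h).choose = x at *
    obtain ⟨g, n⟩ := x
    dsimp only at h1 h2 h3 h4 ⊢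
    by_cases hij : i = j
    · subst hij
      obtain ⟨rfl, rfl⟩ := G.pathComp_inj h1 hfm h2 (h3.trans hf.symm)
      rfl
    have hd : G.deg g + G.deg n = G.deg f + G.deg m := by
      rw [← G.deg_pathComp h1, ← G.deg_pathComp hfm, h2]
    have hmi : G.deg m i ≠ 0 := by
      have := congrFun hd i
      simp only [h3, hf, Pi.add_apply, basisVec, Pi.single_eq_same, Pi.single_eq_of_ne hij] at this
      omega
    -- The path `m` contains an edge of colour `i`, so `m = g' r`. Refactoring `f g' = a b` with the
    -- colours exchanged gives `f m = a (b r)`, and unique factorization identifies `a` with the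
    -- chosen edge and `b r` with its remainder.
    obtain ⟨d, hd'⟩ := exists_basisVec_add hmi
    obtain ⟨g', r, hr, rfl, hg', hrd⟩ := G.exists_pathComp hd'
    rw [pathComp_right hr] at hfm
    obtain ⟨a, b, hab, hc, ha, hb⟩ := G.exists_pathComp (l := pathComp f g') (m := basisVec i)
      (n := basisVec j) (by rw [G.deg_pathComp hfm, hf, hg', add_comm])
    have hbr : r.right = b.left := by
      rw [hr, ← pathComp_left hfm, ← hc, pathComp_left hab]
    obtain ⟨rfl, rfl⟩ := G.pathComp_inj h1 (by rw [pathComp_right hbr, hab])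
      (by rw [h2, ← pathComp_assoc hfm hr, ← hc, pathComp_assoc hab hbr]) (h3.trans ha.symm)
    have hrN : ∑ x, G.deg r x = N := by
      rw [hrd]; exact sum_eq_of_eq_basisVec_add hd' hm
    rw [ih j b r hb hrN hbr, ih i g' r hg' hrN hr, ← mul_assoc, ← mul_assoc,
      hS.commute i j g b f g' ha hb hf hg' hab hfm hc]

theorem IsEdgeFamily.pathFamily_edge_mul (hS : IsEdgeFamily hfin S) {i₀ j : Fin k}
    {f m : Arrow Λ} (hf : G.deg f = basisVec j) (hfm : m.right = f.left) :
    pathFamily hfin S i₀ (pathComp f m) = S f * pathFamily hfin S i₀ m := by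
  have h : ∑ x, G.deg (pathComp f m) x = ∑ x, G.deg m x + 1 := by
    simp only [G.deg_pathComp hfm, Pi.add_apply, Finset.sum_add_distrib, hf, sum_basisVec]
    omega
  rw [pathFamily, h, hS.pathProd_edge_mul i₀ _ j f m hf rfl hfm, pathFamily]

theorem pathFamily_id (i₀ : Fin k) (a : Λ) :
    pathFamily hfin S i₀ (Arrow.mk (𝟙 a)) = vertexProj hfin S i₀ a := by
  simp [pathFamily, G.deg_id, pathProd]

theorem IsEdgeFamily.pathFamily_edge (hS : IsEdgeFamily hfin S) {i₀ j : Fin k}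
    {f : Arrow Λ} (hf : G.deg f = basisVec j) : pathFamily hfin S i₀ f = S f := by
  conv_lhs => rw [← pathComp_id f]
  rw [hS.pathFamily_edge_mul hf rfl, pathFamily_id, vertexProj, ← hS.star_mul_self j i₀ f hf,
    ← mul_assoc, hS.partialIsometry j f hf]

theorem IsEdgeFamily.sum_edge_mul_star (hS : IsEdgeFamily hfin S) (i₀ i : Fin k) (n : Fin k → ℕ)
    (a : Λ) :
    ∑ l ∈ (hfin.pathsInto a (basisVec i + n)).toFinset,
      pathFamily hfin S i₀ l * star (pathFamily hfin S i₀ l) =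
    ∑ f ∈ (hfin.pathsInto a (basisVec i)).toFinset,
      S f * (∑ m ∈ (hfin.pathsInto f.left n).toFinset,
        pathFamily hfin S i₀ m * star (pathFamily hfin S i₀ m)) * star (S f) := by
  rw [sum_pathsInto_add hfin]
  refine Finset.sum_congr rfl fun f hf => ?_
  rw [Finset.mul_sum, Finset.sum_mul]
  refine Finset.sum_congr rfl fun m hm => ?_
  rw [Set.Finite.mem_toFinset] at hf hm
  rw [hS.pathFamily_edge_mul hf.2 hm.1, star_mul]
  simp only [mul_assoc]

/-- The inner sum over edges of colour `j` is `S_f* S_f`, absorbed by the partial isometry `S_f`.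
The right side is symmetric in `i` and `j`, which yields independence of the colour. -/
theorem IsEdgeFamily.vertexProj_eq_sum (hS : IsEdgeFamily hfin S) (i₀ i j : Fin k) (a : Λ) :
    vertexProj hfin S i a = ∑ l ∈ (hfin.pathsInto a (basisVec i + basisVec j)).toFinset,
      pathFamily hfin S i₀ l * star (pathFamily hfin S i₀ l) := by
  rw [hS.sum_edge_mul_star, vertexProj]
  refine Finset.sum_congr rfl fun f hf => ?_
  rw [Set.Finite.mem_toFinset] at hf
  have : ∑ m ∈ (hfin.pathsInto f.left (basisVec j)).toFinset,
      pathFamily hfin S i₀ m * star (pathFamily hfin S i₀ m) = star (S f) * S f := by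
    rw [hS.star_mul_self i j f hf.2]
    refine Finset.sum_congr rfl fun m hm => ?_
    rw [Set.Finite.mem_toFinset] at hm
    rw [hS.pathFamily_edge hm.2]
  rw [this, ← mul_assoc, hS.partialIsometry i f hf.2]

theorem IsEdgeFamily.vertexProj_eq (hS : IsEdgeFamily hfin S) (i j : Fin k) (a : Λ) :
    vertexProj hfin S i a = vertexProj hfin S j a := by
  rw [hS.vertexProj_eq_sum i i j, hS.vertexProj_eq_sum i j i, add_comm (basisVec j)]

theorem IsEdgeFamily.vertexProj_mul_edge (hS : IsEdgeFamily hfin S) {i₀ i : Fin k} {f : Arrow Λ}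
    (hf : G.deg f = basisVec i) : vertexProj hfin S i₀ f.right * S f = S f := by
  rw [hS.vertexProj_eq i₀ i, vertexProj, Finset.sum_mul, Finset.sum_eq_single f]
  · exact hS.partialIsometry i f hf
  · intro g hg hgf
    rw [Set.Finite.mem_toFinset] at hg
    rw [mul_assoc, hS.star_mul_of_ne i g f hg.2 hf hgf, mul_zero]
  · intro h
    exact absurd ((hfin.pathsInto f.right (basisVec i)).mem_toFinset.2 ⟨rfl, hf⟩) h

theorem IsEdgeFamily.vertexProj_mul_of_ne (hS : IsEdgeFamily hfin S) {i₀ i : Fin k} {f : Arrow Λ}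
    (hf : G.deg f = basisVec i) {a : Λ} (ha : a ≠ f.right) : vertexProj hfin S i₀ a * S f = 0 := by
  rw [hS.vertexProj_eq i₀ i, vertexProj, Finset.sum_mul]
  refine Finset.sum_eq_zero fun g hg => ?_
  rw [Set.Finite.mem_toFinset] at hg
  rw [mul_assoc, hS.star_mul_of_ne i g f hg.2 hf (fun h => ha (by rw [← h, hg.1])), mul_zero]

theorem IsEdgeFamily.isStarProjection_vertexProj (hS : IsEdgeFamily hfin S) (i₀ : Fin k) (a : Λ) :
    IsStarProjection (vertexProj hfin S i₀ a) where
  isIdempotentElem := by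
    rw [IsIdempotentElem]
    conv_lhs => enter [2]; rw [vertexProj]
    rw [Finset.mul_sum, vertexProj]
    refine Finset.sum_congr rfl fun f hf => ?_
    rw [Set.Finite.mem_toFinset] at hf
    rw [← mul_assoc]
    obtain ⟨rfl, hd⟩ := hf
    exact congrArg (· * _) (hS.vertexProj_mul_edge hd)
  isSelfAdjoint := by
    simp [IsSelfAdjoint, vertexProj, star_sum, star_mul]

theorem IsEdgeFamily.vertexProj_mul_vertexProj (hS : IsEdgeFamily hfin S) (i₀ : Fin k) {a b : Λ}
    (hab : a ≠ b) : vertexProj hfin S i₀ a * vertexProj hfin S i₀ b = 0 := by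
  conv_lhs => enter [2]; rw [vertexProj]
  rw [Finset.mul_sum]
  refine Finset.sum_eq_zero fun f hf => ?_
  rw [Set.Finite.mem_toFinset] at hf
  rw [← mul_assoc, hS.vertexProj_mul_of_ne hf.2 (by rwa [hf.1]), zero_mul]

theorem path_induction (G : HigherRankGraph k Λ) {motive : Arrow Λ → Prop}
    (id : ∀ a, motive (Arrow.mk (𝟙 a)))
    (edge_comp : ∀ (i : Fin k) (f m : Arrow Λ), G.deg f = basisVec i → m.right = f.left →
      motive m → motive (pathComp f m)) (l : Arrow Λ) : motive l := by
  induction h : ∑ j, G.deg l j generalizing l with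
  | zero =>
    rw [G.eq_id_of_deg_eq_zero (eq_zero_of_sum_eq_zero h)]
    exact id _
  | succ N ih =>
    obtain ⟨⟨f, m⟩, h1, rfl, ⟨i, hi⟩, h3⟩ := exists_edge_pathComp h
    exact edge_comp i f m hi h1 (ih m h3)

theorem IsEdgeFamily.vertexProj_mul_pathFamily (hS : IsEdgeFamily hfin S) (i₀ : Fin k)
    (l : Arrow Λ) :
    vertexProj hfin S i₀ l.right * pathFamily hfin S i₀ l = pathFamily hfin S i₀ l := by
  induction l using path_induction G with
  | id a =>
    rw [pathFamily_id]
    exact (hS.isStarProjection_vertexProj i₀ a).isIdempotentElem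
  | edge_comp i f m hf hm _ =>
    rw [hS.pathFamily_edge_mul hf hm, pathComp_right hm, ← mul_assoc, hS.vertexProj_mul_edge hf]

theorem IsEdgeFamily.pathFamily_mul (hS : IsEdgeFamily hfin S) (i₀ : Fin k) (l m : Arrow Λ)
    (h : m.right = l.left) :
    pathFamily hfin S i₀ l * pathFamily hfin S i₀ m = pathFamily hfin S i₀ (pathComp l m) := by
  induction l using path_induction G with
  | id a =>
    obtain rfl : m.right = a := h
    rw [id_pathComp, pathFamily_id, hS.vertexProj_mul_pathFamily]
  | edge_comp i f l hf hl ih =>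
    rw [pathComp_left hl] at h
    rw [pathComp_assoc hl h, hS.pathFamily_edge_mul hf hl,
      hS.pathFamily_edge_mul hf (by rw [pathComp_right h, hl]), mul_assoc, ih h]

theorem IsEdgeFamily.star_pathFamily_mul (hS : IsEdgeFamily hfin S) (i₀ : Fin k) (l : Arrow Λ) :
    star (pathFamily hfin S i₀ l) * pathFamily hfin S i₀ l = vertexProj hfin S i₀ l.left := by
  induction l using path_induction G with
  | id a =>
    rw [pathFamily_id, (hS.isStarProjection_vertexProj i₀ a).isSelfAdjoint.star_eq]
    exact (hS.isStarProjection_vertexProj i₀ a).isIdempotentElem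
  | edge_comp i f l hf hl ih =>
    rw [hS.pathFamily_edge_mul hf hl, pathComp_left hl, star_mul, mul_assoc,
      ← mul_assoc (star (S f)), hS.star_mul_self i i₀ f hf, ← hl,
      ← ih]
    exact congrArg (_ * ·) (hS.vertexProj_mul_pathFamily i₀ l)

/-- Induction on the total degree: splitting off a first edge `f` leaves `S_f P S_f*` with `P` the
vertex projection at `s(f)`, and `P = S_f* S_f`. -/
theorem IsEdgeFamily.sum_pathFamily_mul_star (hS : IsEdgeFamily hfin S) (i₀ : Fin k) (a : Λ)
    (n : Fin k → ℕ) :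
    ∑ l ∈ (hfin.pathsInto a n).toFinset,
      pathFamily hfin S i₀ l * star (pathFamily hfin S i₀ l) = vertexProj hfin S i₀ a := by
  induction h : ∑ j, n j generalizing a n with
  | zero =>
    rw [eq_zero_of_sum_eq_zero h, Finset.sum_eq_single (Arrow.mk (𝟙 a))]
    · rw [pathFamily_id, (hS.isStarProjection_vertexProj i₀ a).isSelfAdjoint.star_eq]
      exact (hS.isStarProjection_vertexProj i₀ a).isIdempotentElem
    · intro l hl hne
      rw [Set.Finite.mem_toFinset] at hl
      exact absurd (hl.1 ▸ G.eq_id_of_deg_eq_zero hl.2) hne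
    · intro h
      exact absurd ((hfin.pathsInto a 0).mem_toFinset.2 ⟨rfl, G.deg_id a⟩) h
  | succ N ih =>
    obtain ⟨i, -, hi⟩ : ∃ i ∈ Finset.univ, n i ≠ 0 :=
      Finset.exists_ne_zero_of_sum_ne_zero (by omega)
    obtain ⟨m, rfl⟩ := exists_basisVec_add hi
    rw [hS.sum_edge_mul_star, hS.vertexProj_eq i₀ i, vertexProj]
    refine Finset.sum_congr rfl fun f hf => ?_
    rw [Set.Finite.mem_toFinset] at hf
    rw [ih f.left m (sum_eq_of_eq_basisVec_add rfl h), vertexProj,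
      ← hS.star_mul_self i i₀ f hf.2, ← mul_assoc, hS.partialIsometry i f hf.2]

theorem IsEdgeFamily.isCKFamily (hS : IsEdgeFamily hfin S) (i₀ : Fin k) :
    G.IsCKFamily (pathFamily hfin S i₀) where
  partialIsometry l := by
    have h := hS.pathFamily_mul i₀ l (Arrow.mk (𝟙 l.left)) rfl
    rw [pathComp_id, pathFamily_id] at h
    rw [mul_assoc, hS.star_pathFamily_mul, h]
  ck1_proj a := by
    rw [pathFamily_id]; exact hS.isStarProjection_vertexProj i₀ a
  ck1_orth a b hab := by
    rw [pathFamily_id, pathFamily_id]; exact hS.vertexProj_mul_vertexProj i₀ hab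
  ck2 g f := by
    rw [hS.pathFamily_mul i₀ _ _ rfl, pathComp_mk]
  ck3 f := by
    rw [hS.star_pathFamily_mul, pathFamily_id]; rfl
  ck4 a n := by
    rw [pathFamily_id, finsum_mem_eq_finite_toFinset_sum _ (hfin.pathsInto a n),
      hS.sum_pathFamily_mul_star]

end EdgeFamily

end HigherRankGraph

/-! ### Multiplication by indicator functions on `L²`. -/

section LpOperators

variable {X : Type w} [MeasurableSpace X] {μ : Measure X}

/-- A linear map of functions that contracts the `L²`-seminorm acts on `L²`. -/
theorem exists_Lp_operator (F : (X → ℂ) → X → ℂ) (hadd : ∀ f g, F (f + g) = F f + F g)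
    (hsmul : ∀ (a : ℂ) f, F (a • f) = a • F f) (hae : ∀ f g, f =ᵐ[μ] g → F f =ᵐ[μ] F g)
    (hmeas : ∀ f, AEStronglyMeasurable f μ → AEStronglyMeasurable (F f) μ)
    (hnorm : ∀ f, AEStronglyMeasurable f μ → eLpNorm (F f) 2 μ ≤ eLpNorm f 2 μ) :
    ∃ T : Lp ℂ 2 μ →L[ℂ] Lp ℂ 2 μ, ∀ ξ : Lp ℂ 2 μ, (T ξ : X → ℂ) =ᵐ[μ] F ξ := by
  have hmem : ∀ ξ : Lp ℂ 2 μ, MemLp (F ξ) 2 μ := fun ξ =>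
    ⟨hmeas _ (Lp.aestronglyMeasurable ξ),
      (hnorm _ (Lp.aestronglyMeasurable ξ)).trans_lt (Lp.eLpNorm_lt_top ξ)⟩
  let T₀ : Lp ℂ 2 μ →ₗ[ℂ] Lp ℂ 2 μ :=
    { toFun := fun ξ => (hmem ξ).toLp
      map_add' := fun ξ η => by
        refine Lp.ext ?_
        filter_upwards [(hmem (ξ + η)).coeFn_toLp, (hmem ξ).coeFn_toLp, (hmem η).coeFn_toLp,
          Lp.coeFn_add (hmem ξ).toLp (hmem η).toLp, hae _ _ (Lp.coeFn_add ξ η)]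
          with x h1 h2 h3 h4 h5
        rw [h1, h4, Pi.add_apply, h2, h3, h5, hadd, Pi.add_apply]
      map_smul' := fun a ξ => by
        refine Lp.ext ?_
        filter_upwards [(hmem (a • ξ)).coeFn_toLp, (hmem ξ).coeFn_toLp,
          Lp.coeFn_smul a (hmem ξ).toLp, hae _ _ (Lp.coeFn_smul a ξ)] with x h1 h2 h3 h4
        rw [h1, h4, RingHom.id_apply, h3, Pi.smul_apply, h2, hsmul, Pi.smul_apply] }
  refine ⟨T₀.mkContinuous 1 fun ξ => ?_, fun ξ => (hmem ξ).coeFn_toLp⟩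
  rw [one_mul]
  change ‖(hmem ξ).toLp‖ ≤ ‖ξ‖
  rw [Lp.norm_toLp, Lp.norm_def]
  exact ENNReal.toReal_mono (Lp.eLpNorm_ne_top ξ) (hnorm _ (Lp.aestronglyMeasurable ξ))

theorem exists_indicatorMul {E : Set X} (hE : MeasurableSet E) :
    ∃ T : Lp ℂ 2 μ →L[ℂ] Lp ℂ 2 μ, ∀ ξ : Lp ℂ 2 μ, (T ξ : X → ℂ) =ᵐ[μ] E.indicator ξ :=
  exists_Lp_operator (fun f => E.indicator f) (fun f g => Set.indicator_add E f g)
    (fun a f => Set.indicator_const_smul E a f)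
    (fun _ _ h => by filter_upwards [h] with x hx; simp only [Set.indicator, hx]) (fun _ h => h.indicator hE)
    (fun f _ => eLpNorm_indicator_le f)

open Classical in
/-- Multiplication by the indicator function of `E` on `L²`; it is `0` if `E` is not measurable. -/
noncomputable def indicatorMul (μ : Measure X) (E : Set X) : Lp ℂ 2 μ →L[ℂ] Lp ℂ 2 μ :=
  if hE : MeasurableSet E then (exists_indicatorMul hE).choose else 0

theorem indicatorMul_apply {E : Set X} (hE : MeasurableSet E) (ξ : Lp ℂ 2 μ) :
    (indicatorMul μ E ξ : X → ℂ) =ᵐ[μ] E.indicator ξ := by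
  rw [indicatorMul, dif_pos hE]
  exact (exists_indicatorMul hE).choose_spec ξ

theorem indicatorMul_congr {E F : Set X} (hE : MeasurableSet E) (hF : MeasurableSet F)
    (h : E =ᵐ[μ] F) : indicatorMul μ E = indicatorMul μ F := by
  ext1 ξ
  refine Lp.ext ?_
  filter_upwards [indicatorMul_apply hE ξ, indicatorMul_apply hF ξ,
    indicator_ae_eq_of_ae_eq_set (f := ξ) h] with x h1 h2 h3
  rw [h1, h2, h3]

theorem indicatorMul_empty : indicatorMul μ ∅ = 0 := by
  ext1 ξ
  refine Lp.ext ?_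
  filter_upwards [indicatorMul_apply MeasurableSet.empty ξ, Lp.coeFn_zero ℂ 2 μ] with x h1 h2
  rw [h1, Set.indicator_empty, zero_apply, h2, Pi.zero_apply]

theorem indicatorMul_union {E F : Set X} (hE : MeasurableSet E) (hF : MeasurableSet F)
    (h : μ (E ∩ F) = 0) : indicatorMul μ (E ∪ F) = indicatorMul μ E + indicatorMul μ F := by
  ext1 ξ
  refine Lp.ext ?_
  rw [add_apply]
  filter_upwards [indicatorMul_apply hE ξ, indicatorMul_apply hF ξ,
    indicatorMul_apply (hE.union hF) ξ, Lp.coeFn_add (indicatorMul μ E ξ) (indicatorMul μ F ξ),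
    measure_eq_zero_iff_ae_notMem.1 h] with x h1 h2 h3 h4 h5
  rw [h3, h4, Pi.add_apply, h1, h2, Set.indicator_union_of_notMem_inter h5]

theorem indicatorMul_mul {E F : Set X} (hE : MeasurableSet E) (hF : MeasurableSet F) :
    indicatorMul μ E * indicatorMul μ F = indicatorMul μ (E ∩ F) := by
  ext1 ξ
  refine Lp.ext ?_
  rw [mul_apply_eq_comp]
  filter_upwards [indicatorMul_apply hE (indicatorMul μ F ξ), indicatorMul_apply hF ξ,
    indicatorMul_apply (hE.inter hF) ξ] with x h1 h2 h3
  rw [h1, h3]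
  by_cases hx : x ∈ E
  · by_cases hx' : x ∈ F <;> simp [hx, hx', h2]
  · simp [hx]

theorem indicatorMul_biUnion {ι : Type*} (s : Finset ι) {E : ι → Set X}
    (hE : ∀ i ∈ s, MeasurableSet (E i))
    (h : ∀ i ∈ s, ∀ j ∈ s, i ≠ j → μ (E i ∩ E j) = 0) :
    indicatorMul μ (⋃ i ∈ s, E i) = ∑ i ∈ s, indicatorMul μ (E i) := by
  classical
  induction s using Finset.induction_on with
  | empty => simpa using indicatorMul_empty
  | insert a s ha ih =>
    rw [Finset.set_biUnion_insert, Finset.sum_insert ha, indicatorMul_union, ih]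
    · exact fun i hi => hE i (Finset.mem_insert_of_mem hi)
    · exact fun i hi j hj => h i (Finset.mem_insert_of_mem hi) j (Finset.mem_insert_of_mem hj)
    · exact hE a (Finset.mem_insert_self a s)
    · exact Finset.measurableSet_biUnion _ fun i hi => hE i (Finset.mem_insert_of_mem hi)
    · rw [Set.inter_iUnion₂]
      refine (measure_biUnion_null_iff s.countable_toSet).2 fun i hi => ?_
      exact h a (Finset.mem_insert_self a s) i (Finset.mem_insert_of_mem hi)
        (fun e => ha (e ▸ hi))

theorem isStarProjection_indicatorMul {E : Set X} (hE : MeasurableSet E) :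
    IsStarProjection (indicatorMul μ E) where
  isIdempotentElem := by
    rw [IsIdempotentElem, indicatorMul_mul hE hE, Set.inter_self]
  isSelfAdjoint := by
    rw [ContinuousLinearMap.isSelfAdjoint_iff_isSymmetric]
    intro ξ η
    simp only [ContinuousLinearMap.coe_coe]
    rw [L2.inner_def, L2.inner_def]
    refine integral_congr_ae ?_
    filter_upwards [indicatorMul_apply hE ξ, indicatorMul_apply hE η] with x h1 h2
    rw [h1, h2]
    by_cases hx : x ∈ E <;> simp [hx]

theorem norm_indicatorMul {E : Set X} (hE : MeasurableSet E) (ξ : Lp ℂ 2 μ) :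
    ‖indicatorMul μ E ξ‖ = (eLpNorm ξ 2 (μ.restrict E)).toReal := by
  rw [Lp.norm_def, eLpNorm_congr_ae (indicatorMul_apply hE ξ),
    eLpNorm_indicator_eq_eLpNorm_restrict hE]

end LpOperators

/-! ### Recognizing initial and final projections of a partial isometry. -/

section PartialIsometry

variable {H : Type w} [NormedAddCommGroup H] [InnerProductSpace ℂ H] [CompleteSpace H]
  {S P Q : H →L[ℂ] H}

theorem mul_of_norm_apply_eq (hP : IsStarProjection P) (h : ∀ x, ‖S x‖ = ‖P x‖) : S * P = S := by
  ext x
  have h1 : P (P x) = P x := DFunLike.congr_fun hP.isIdempotentElem.eq x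
  have h2 : ‖S (P x - x)‖ = 0 := by rw [h, map_sub, h1, sub_self, norm_zero]
  rw [norm_eq_zero, map_sub, sub_eq_zero] at h2
  exact h2

/-- The quadratic forms of `S* S` and `P* P = P` coincide, and over `ℂ` a quadratic form determines
the operator. -/
theorem star_mul_self_of_norm_apply_eq (hP : IsStarProjection P) (h : ∀ x, ‖S x‖ = ‖P x‖) :
    star S * S = P := by
  have hPP : star P * P = P := by
    rw [hP.isSelfAdjoint.star_eq, hP.isIdempotentElem.eq]
  apply ContinuousLinearMap.coe_injective
  rw [← ext_inner_map]
  intro x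
  conv_rhs => rw [← hPP]
  simp only [ContinuousLinearMap.coe_coe, mul_apply_eq_comp,
    ContinuousLinearMap.star_eq_adjoint, ContinuousLinearMap.adjoint_inner_left,
    inner_self_eq_norm_sq_to_K, h]

/-- `S S*` fixes the range of `S`, which contains that of `Q`, so `S S* Q = Q`. Its adjoint `Q S S*
= Q` combines with `Q S = S`. -/
theorem mul_star_self_of_range_eq (hQ : IsStarProjection Q) (hS : S * star S * S = S)
    (hQS : Q * S = S) (hsurj : ∀ y, ∃ x, S x = Q y) : S * star S = Q := by
  have h : S * star S * Q = Q := by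
    ext y
    obtain ⟨x, hx⟩ := hsurj y
    rw [mul_apply_eq_comp, ← hx]
    exact DFunLike.congr_fun hS x
  have h' := congrArg star h
  simp only [star_mul, star_star, hQ.isSelfAdjoint.star_eq] at h'
  rw [← h', ← mul_assoc, hQS]

end PartialIsometry

/-! ### Weighted composition operators of a single branch and their products. -/

section Branch

variable {X : Type w} [MeasurableSpace X] {μ : Measure X}

/-- A partial map `σ : D → X` with measurable left inverse `c` such that `μ ∘ σ` has the a.e.
positive density `Φ` with respect to `μ` on `D`. -/
structure IsBranch (μ : Measure X) (D : Set X) (σ : X → X) (Φ : X → ℝ) (c : X → X) : Prop where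
  measurableSet_dom : MeasurableSet D
  measurable_map : Measurable (D.domRestrict σ)
  measurable_deriv : Measurable Φ
  measurableSet_image : ∀ E ⊆ D, MeasurableSet E → MeasurableSet (σ '' E)
  measure_image : ∀ E ⊆ D, MeasurableSet E → μ (σ '' E) = ∫⁻ x in E, ENNReal.ofReal (Φ x) ∂μ
  pos : ∀ᵐ x ∂μ, x ∈ D → 0 < Φ x
  measurable_coding : Measurable c
  coding_apply : ∀ x ∈ D, c (σ x) = x

/-- The weighted composition `χ_R (Φ ∘ c)^{-1/2} (ξ ∘ c)`. -/
noncomputable def weightedComp (R : Set X) (Φ : X → ℝ) (c : X → X) (ξ : X → ℂ) : X → ℂ :=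
  R.indicator fun x => ((Φ (c x) ^ (-(1 / 2) : ℝ) : ℝ) : ℂ) * ξ (c x)

theorem measurable_indicator_comp_of_domRestrict {β : Type*} [MeasurableSpace β] [Zero β]
    {D : Set X} {σ : X → X} {g : X → β} (hD : MeasurableSet D)
    (hσ : Measurable (D.domRestrict σ)) (hg : Measurable g) :
    Measurable (D.indicator fun x => g (σ x)) := by
  refine measurable_of_restrict_of_restrict_compl hD ?_ ?_
  · have : D.domRestrict (D.indicator fun x => g (σ x)) = g ∘ D.domRestrict σ := by
      ext x; simp [x.2]
    rw [this]
    exact hg.comp hσ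
  · have : Dᶜ.domRestrict (D.indicator fun x => g (σ x)) = fun _ => 0 := by
      ext x; exact Set.indicator_of_notMem x.2 _
    rw [this]
    exact measurable_const

namespace IsBranch

variable {D : Set X} {σ : X → X} {Φ : X → ℝ} {c : X → X}

theorem measurableSet_range (h : IsBranch μ D σ Φ c) : MeasurableSet (σ '' D) :=
  h.measurableSet_image D subset_rfl h.measurableSet_dom

theorem image_inter_preimage (h : IsBranch μ D σ Φ c) (E : Set X) :
    c ⁻¹' E ∩ σ '' D = σ '' (E ∩ D) := by
  ext x
  constructor
  · rintro ⟨hx, y, hy, rfl⟩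
    rw [Set.mem_preimage, h.coding_apply y hy] at hx
    exact ⟨y, ⟨hx, hy⟩, rfl⟩
  · rintro ⟨y, ⟨hx, hy⟩, rfl⟩
    refine ⟨?_, y, hy, rfl⟩
    rwa [Set.mem_preimage, h.coding_apply y hy]

/-- The change of variables expressed through `c`, which is measurable on all of `X`, whereas `σ` is
controlled only on `D`. -/
theorem measurePreserving_coding (h : IsBranch μ D σ Φ c) :
    MeasurePreserving c (μ.restrict (σ '' D))
      ((μ.restrict D).withDensity fun x => ENNReal.ofReal (Φ x)) := by
  refine ⟨h.measurable_coding, Measure.ext fun E hE => ?_⟩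
  rw [Measure.map_apply h.measurable_coding hE,
    Measure.restrict_apply (h.measurable_coding hE), h.image_inter_preimage,
    h.measure_image _ Set.inter_subset_right (hE.inter h.measurableSet_dom),
    withDensity_apply _ hE, Measure.restrict_restrict hE]

theorem quasiMeasurePreserving_coding (h : IsBranch μ D σ Φ c) :
    Measure.QuasiMeasurePreserving c (μ.restrict (σ '' D)) (μ.restrict D) :=
  h.measurePreserving_coding.quasiMeasurePreserving.mono_right
    (withDensity_absolutelyContinuous _ _)

/-- A property that holds a.e. on `D` holds a.e. on `R = σ(D)` after composition with `c`. -/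
theorem ae_coding (h : IsBranch μ D σ Φ c) {p : X → Prop} (hp : ∀ᵐ x ∂μ, x ∈ D → p x) :
    ∀ᵐ x ∂μ, x ∈ σ '' D → p (c x) :=
  (ae_restrict_iff' h.measurableSet_range).1
    (h.quasiMeasurePreserving_coding.ae ((ae_restrict_iff' h.measurableSet_dom).2 hp))

theorem weightedComp_congr (h : IsBranch μ D σ Φ c) {f g : X → ℂ} (hfg : f =ᵐ[μ] g) :
    weightedComp (σ '' D) Φ c f =ᵐ[μ] weightedComp (σ '' D) Φ c g := by
  filter_upwards [h.ae_coding (hfg.mono fun x hx _ => hx)] with x hx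
  by_cases hxR : x ∈ σ '' D
  · simp only [weightedComp, Set.indicator_of_mem hxR, hx hxR]
  · simp only [weightedComp, Set.indicator_of_notMem hxR]

theorem aestronglyMeasurable_weight_mul (h : IsBranch μ D σ Φ c) {ξ : X → ℂ}
    (hξ : AEStronglyMeasurable ξ μ) :
    AEStronglyMeasurable (fun x => ((Φ x ^ (-(1 / 2) : ℝ) : ℝ) : ℂ) * ξ x)
      ((μ.restrict D).withDensity fun x => ENNReal.ofReal (Φ x)) := by
  refine (AEStronglyMeasurable.mul ?_ hξ.restrict).mono_ac (withDensity_absolutelyContinuous _ _)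
  exact (Complex.measurable_ofReal.comp
    (h.measurable_deriv.pow_const (-(1 / 2) : ℝ))).aestronglyMeasurable

theorem aestronglyMeasurable_weightedComp (h : IsBranch μ D σ Φ c) {ξ : X → ℂ}
    (hξ : AEStronglyMeasurable ξ μ) :
    AEStronglyMeasurable (weightedComp (σ '' D) Φ c ξ) μ := by
  rw [weightedComp, aestronglyMeasurable_indicator_iff h.measurableSet_range]
  exact (h.aestronglyMeasurable_weight_mul hξ).comp_measurePreserving h.measurePreserving_coding

theorem enorm_weight_mul {t : ℝ} (ht : 0 < t) (z : ℂ) :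
    ENNReal.ofReal t * ‖((t ^ (-(1 / 2) : ℝ) : ℝ) : ℂ) * z‖ₑ ^ (2 : ℝ) = ‖z‖ₑ ^ (2 : ℝ) := by
  have h1 : ‖((t ^ (-(1 / 2) : ℝ) : ℝ) : ℂ)‖ₑ = ENNReal.ofReal (t ^ (-(1 / 2) : ℝ)) := by
    rw [← ofReal_norm, Complex.norm_real, Real.norm_of_nonneg (by positivity)]
  have h2 : t * (t ^ (-(1 / 2) : ℝ)) ^ (2 : ℝ) = 1 := by
    rw [← Real.rpow_mul ht.le]
    norm_num [Real.rpow_neg_one, ht.ne']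
  rw [enorm_mul, ENNReal.mul_rpow_of_nonneg _ _ (by norm_num), ← mul_assoc, h1,
    ENNReal.ofReal_rpow_of_nonneg (by positivity) (by norm_num), ← ENNReal.ofReal_mul ht.le, h2,
    ENNReal.ofReal_one, one_mul]

theorem eLpNorm_weightedComp (h : IsBranch μ D σ Φ c) {ξ : X → ℂ}
    (hξ : AEStronglyMeasurable ξ μ) :
    eLpNorm (weightedComp (σ '' D) Φ c ξ) 2 μ = eLpNorm ξ 2 (μ.restrict D) := by
  have hw := h.aestronglyMeasurable_weight_mul hξ
  rw [weightedComp, eLpNorm_indicator_eq_eLpNorm_restrict h.measurableSet_range]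
  refine (eLpNorm_comp_measurePreserving hw h.measurePreserving_coding).trans ?_
  rw [eLpNorm_eq_lintegral_rpow_enorm_toReal two_ne_zero ENNReal.ofNat_ne_top,
    eLpNorm_eq_lintegral_rpow_enorm_toReal two_ne_zero ENNReal.ofNat_ne_top,
    lintegral_withDensity_eq_lintegral_mul₀' h.measurable_deriv.ennreal_ofReal.aemeasurable
      (hw.enorm.pow_const _)]
  congr 1
  refine lintegral_congr_ae ?_
  filter_upwards [(ae_restrict_iff' h.measurableSet_dom).2 h.pos] with x hx
  rw [Pi.mul_apply, ENNReal.toReal_ofNat, enorm_weight_mul hx]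

theorem exists_operator (h : IsBranch μ D σ Φ c) : ∃ S : Lp ℂ 2 μ →L[ℂ] Lp ℂ 2 μ,
    ∀ ξ : Lp ℂ 2 μ, (S ξ : X → ℂ) =ᵐ[μ] weightedComp (σ '' D) Φ c ξ := by
  refine exists_Lp_operator _ (fun f g => ?_) (fun a f => ?_) (fun f g => h.weightedComp_congr)
    (fun f => h.aestronglyMeasurable_weightedComp) (fun f hf => ?_)
  · ext x
    by_cases hx : x ∈ σ '' D <;> simp [weightedComp, hx, mul_add]
  · ext x
    by_cases hx : x ∈ σ '' D <;> simp [weightedComp, hx, mul_left_comm]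
  · rw [h.eLpNorm_weightedComp hf]
    exact eLpNorm_restrict_le _ _ _ _

section Operator

variable {S : Lp ℂ 2 μ →L[ℂ] Lp ℂ 2 μ}

theorem norm_operator (h : IsBranch μ D σ Φ c)
    (hS : ∀ ξ : Lp ℂ 2 μ, (S ξ : X → ℂ) =ᵐ[μ] weightedComp (σ '' D) Φ c ξ) (ξ : Lp ℂ 2 μ) :
    ‖S ξ‖ = ‖indicatorMul μ D ξ‖ := by
  rw [norm_indicatorMul h.measurableSet_dom, Lp.norm_def, eLpNorm_congr_ae (hS ξ),
    h.eLpNorm_weightedComp (Lp.aestronglyMeasurable ξ)]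

theorem star_mul_self (h : IsBranch μ D σ Φ c)
    (hS : ∀ ξ : Lp ℂ 2 μ, (S ξ : X → ℂ) =ᵐ[μ] weightedComp (σ '' D) Φ c ξ) :
    star S * S = indicatorMul μ D :=
  star_mul_self_of_norm_apply_eq (isStarProjection_indicatorMul h.measurableSet_dom)
    (h.norm_operator hS)

theorem mul_star_mul_self (h : IsBranch μ D σ Φ c)
    (hS : ∀ ξ : Lp ℂ 2 μ, (S ξ : X → ℂ) =ᵐ[μ] weightedComp (σ '' D) Φ c ξ) :
    S * star S * S = S := by
  rw [mul_assoc, h.star_mul_self hS,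
    mul_of_norm_apply_eq (isStarProjection_indicatorMul h.measurableSet_dom) (h.norm_operator hS)]

theorem indicatorMul_mul_operator (h : IsBranch μ D σ Φ c)
    (hS : ∀ ξ : Lp ℂ 2 μ, (S ξ : X → ℂ) =ᵐ[μ] weightedComp (σ '' D) Φ c ξ) :
    indicatorMul μ (σ '' D) * S = S := by
  ext1 ξ
  refine Lp.ext ?_
  rw [mul_apply_eq_comp]
  filter_upwards [indicatorMul_apply h.measurableSet_range (S ξ), hS ξ] with x h1 h2
  rw [h1]
  by_cases hx : x ∈ σ '' D
  · rw [Set.indicator_of_mem hx]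
  · rw [Set.indicator_of_notMem hx, h2, weightedComp, Set.indicator_of_notMem hx]

theorem exists_operator_eq (h : IsBranch μ D σ Φ c)
    (hS : ∀ ξ : Lp ℂ 2 μ, (S ξ : X → ℂ) =ᵐ[μ] weightedComp (σ '' D) Φ c ξ) (η : Lp ℂ 2 μ) :
    ∃ ξ, S ξ = indicatorMul μ (σ '' D) η := by
  have hη : Measurable (η : X → ℂ) := (Lp.stronglyMeasurable η).measurable
  -- The preimage undoes both the composition and the weight. The indicator is needed for
  -- measurability, as `σ` is uncontrolled off `D`.
  set ζ : X → ℂ := fun y => ((Φ y ^ (1 / 2 : ℝ) : ℝ) : ℂ) * D.indicator (fun y => η (σ y)) y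
    with hζ
  have hm : AEStronglyMeasurable ζ μ :=
    ((Complex.measurable_ofReal.comp (h.measurable_deriv.pow_const (1 / 2 : ℝ))).mul
      (measurable_indicator_comp_of_domRestrict h.measurableSet_dom h.measurable_map
        hη)).aestronglyMeasurable
  have hζη : weightedComp (σ '' D) Φ c ζ =ᵐ[μ] (σ '' D).indicator η := by
    filter_upwards [h.ae_coding h.pos] with x hx
    by_cases hxR : x ∈ σ '' D
    · have hpos := hx hxR
      rw [weightedComp, Set.indicator_of_mem hxR, Set.indicator_of_mem hxR]
      obtain ⟨y, hy, rfl⟩ := hxR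
      rw [h.coding_apply y hy] at hpos ⊢
      simp only [hζ, Set.indicator_of_mem hy]
      rw [← mul_assoc, ← Complex.ofReal_mul, ← Real.rpow_add hpos]
      norm_num
    · simp only [weightedComp, Set.indicator_of_notMem hxR]
  have hmem : MemLp ζ 2 μ := by
    refine ⟨hm, ?_⟩
    have hζD : ζ = D.indicator ζ := by
      ext y
      by_cases hy : y ∈ D <;> simp [hζ, hy]
    rw [hζD, eLpNorm_indicator_eq_eLpNorm_restrict h.measurableSet_dom,
      ← h.eLpNorm_weightedComp hm, eLpNorm_congr_ae hζη]
    exact (eLpNorm_indicator_le _).trans_lt (Lp.eLpNorm_lt_top η)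
  refine ⟨hmem.toLp, Lp.ext ?_⟩
  exact (hS _).trans ((h.weightedComp_congr hmem.coeFn_toLp).trans
    (hζη.trans (indicatorMul_apply h.measurableSet_range η).symm))

theorem mul_star_self (h : IsBranch μ D σ Φ c)
    (hS : ∀ ξ : Lp ℂ 2 μ, (S ξ : X → ℂ) =ᵐ[μ] weightedComp (σ '' D) Φ c ξ) :
    S * star S = indicatorMul μ (σ '' D) :=
  mul_star_self_of_range_eq (isStarProjection_indicatorMul h.measurableSet_range)
    (h.mul_star_mul_self hS) (h.indicatorMul_mul_operator hS) (h.exists_operator_eq hS)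

end Operator

section Comp

variable {E : Set X} {ρ : X → X} {Ψ : X → ℝ} {e : X → X}

theorem setLIntegral_image (h : IsBranch μ D σ Φ c) {A : Set X} (hA : A ⊆ D)
    (hAm : MeasurableSet A) {g : X → ℝ≥0∞} (hg : Measurable g) :
    ∫⁻ x in σ '' A, g x ∂μ = ∫⁻ y in A, ENNReal.ofReal (Φ y) * g (σ y) ∂μ := by
  have hm : Measurable (D.indicator fun y => g (σ y)) :=
    measurable_indicator_comp_of_domRestrict h.measurableSet_dom h.measurable_map hg
  have h1 := h.measurePreserving_coding.setLIntegral_comp_preimage hAm hm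
  rw [Measure.restrict_restrict (h.measurable_coding hAm), h.image_inter_preimage,
    Set.inter_eq_left.2 hA, restrict_withDensity hAm,
    lintegral_withDensity_eq_lintegral_mul _ h.measurable_deriv.ennreal_ofReal hm,
    Measure.restrict_restrict hAm, Set.inter_eq_left.2 hA] at h1
  rw [← setLIntegral_congr_fun (h.measurableSet_image A hA hAm) (f := fun x =>
    D.indicator (fun y => g (σ y)) (c x)), h1]
  · refine setLIntegral_congr_fun hAm fun y hy => ?_
    rw [Pi.mul_apply, Set.indicator_of_mem (hA hy)]
  · rintro _ ⟨y, hy, rfl⟩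
    dsimp only
    rw [h.coding_apply y (hA hy), Set.indicator_of_mem (hA hy)]

/-- The chain rule for densities, obtained from `setLIntegral_image` applied to `Φ`. -/
theorem comp (h : IsBranch μ D σ Φ c) (h' : IsBranch μ E ρ Ψ e) (hED : ρ '' E ⊆ D) :
    IsBranch μ E (σ ∘ ρ) (fun y => Ψ y * E.indicator (fun y => Φ (ρ y)) y) (e ∘ c) where
  measurableSet_dom := h'.measurableSet_dom
  measurable_map := by
    have : E.domRestrict (σ ∘ ρ) = D.domRestrict σ ∘ fun y : E =>
      (⟨E.domRestrict ρ y, hED ⟨y, y.2, rfl⟩⟩ : D) := rfl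
    rw [this]
    exact h.measurable_map.comp (h'.measurable_map.subtype_mk)
  measurable_deriv := h'.measurable_deriv.mul (measurable_indicator_comp_of_domRestrict
    h'.measurableSet_dom h'.measurable_map h.measurable_deriv)
  measurableSet_image A hA hAm := by
    rw [Set.image_comp]
    exact h.measurableSet_image _ ((Set.image_mono hA).trans hED) (h'.measurableSet_image A hA hAm)
  measure_image A hA hAm := by
    rw [Set.image_comp, h.measure_image _ ((Set.image_mono hA).trans hED)
      (h'.measurableSet_image A hA hAm),
      h'.setLIntegral_image hA hAm h.measurable_deriv.ennreal_ofReal]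
    refine setLIntegral_congr_fun_ae hAm ?_
    filter_upwards [h'.pos] with y hy hyA
    rw [Set.indicator_of_mem (hA hyA), ENNReal.ofReal_mul (hy (hA hyA)).le]
  pos := by
    -- The bad points of `E` are carried by `ρ` into the null set of `D` where `Φ ≤ 0`. Their image
    -- having measure zero means that `Ψ` has integral zero over them, and `Ψ > 0` a.e. on `E` makes
    -- them null.
    have h1 : μ (ρ '' (E ∩ ρ ⁻¹' {x | Φ x ≤ 0})) = 0 := by
      refine measure_mono_null ?_ (ae_iff.1 h.pos)
      rintro _ ⟨y, ⟨hy, hy'⟩, rfl⟩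
      simp only [Set.mem_ofPred_eq, Classical.not_imp, not_lt]
      exact ⟨hED ⟨y, hy, rfl⟩, hy'⟩
    have hA : MeasurableSet (E ∩ ρ ⁻¹' {x | Φ x ≤ 0}) := by
      have := h'.measurableSet_dom.subtype_image
        (h'.measurable_map (h.measurable_deriv measurableSet_Iic : MeasurableSet (Φ ⁻¹' Set.Iic 0)))
      convert this using 1
      ext y
      simp [and_comm]
    rw [h'.measure_image _ Set.inter_subset_left hA,
      lintegral_eq_zero_iff h'.measurable_deriv.ennreal_ofReal] at h1
    filter_upwards [(ae_restrict_iff' hA).1 h1, h'.pos] with y h2 h3 hy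
    rw [Set.indicator_of_mem hy]
    refine mul_pos (h3 hy) (not_le.1 fun h4 => ?_)
    have := h2 ⟨hy, h4⟩
    rw [Pi.zero_apply, ENNReal.ofReal_eq_zero] at this
    exact absurd (h3 hy) (not_lt.2 this)
  measurable_coding := h'.measurable_coding.comp h.measurable_coding
  coding_apply y hy := by
    rw [Function.comp_apply, Function.comp_apply, h.coding_apply _ (hED ⟨y, hy, rfl⟩),
      h'.coding_apply y hy]

theorem operator_mul (h : IsBranch μ D σ Φ c) (h' : IsBranch μ E ρ Ψ e) (hED : ρ '' E ⊆ D)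
    {S T : Lp ℂ 2 μ →L[ℂ] Lp ℂ 2 μ}
    (hS : ∀ ξ : Lp ℂ 2 μ, (S ξ : X → ℂ) =ᵐ[μ] weightedComp (σ '' D) Φ c ξ)
    (hT : ∀ ξ : Lp ℂ 2 μ, (T ξ : X → ℂ) =ᵐ[μ] weightedComp (ρ '' E) Ψ e ξ) (ξ : Lp ℂ 2 μ) :
    ((S * T) ξ : X → ℂ) =ᵐ[μ] weightedComp ((σ ∘ ρ) '' E)
      (fun y => Ψ y * E.indicator (fun y => Φ (ρ y)) y) (e ∘ c) ξ := by
  rw [mul_apply_eq_comp]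
  filter_upwards [(hS (T ξ)).trans (h.weightedComp_congr (hT ξ)),
    (h.comp h' hED).ae_coding h'.pos, (h.comp h' hED).ae_coding (h.comp h' hED).pos]
    with x h1 h2 h3
  rw [h1]
  by_cases hx : x ∈ (σ ∘ ρ) '' E
  · have h4 := h2 hx
    have h5 := h3 hx
    rw [weightedComp, weightedComp, weightedComp, Set.indicator_of_mem hx]
    obtain ⟨y, hy, rfl⟩ := hx
    have hρ : ρ y ∈ ρ '' E := ⟨y, hy, rfl⟩
    have hσ : σ (ρ y) ∈ σ '' D := ⟨ρ y, hED hρ, rfl⟩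
    have hc : (e ∘ c) ((σ ∘ ρ) y) = y := (h.comp h' hED).coding_apply y hy
    rw [hc] at h4 h5 ⊢
    rw [Set.indicator_of_mem hy] at h5 ⊢
    have h6 := pos_of_mul_pos_right h5 h4.le
    rw [Function.comp_apply, Set.indicator_of_mem hσ, h.coding_apply _ (hED hρ),
      Set.indicator_of_mem hρ, h'.coding_apply y hy, Real.mul_rpow h4.le h6.le]
    push_cast
    ring
  · simp only [weightedComp]
    rw [Set.indicator_of_notMem hx]
    by_cases hxR : x ∈ σ '' D
    · rw [Set.indicator_of_mem hxR]
      obtain ⟨z, hz, rfl⟩ := hxR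
      -- Here `x = σ z` with `z` outside `ρ(E)`, so the inner factor vanishes.
      rw [h.coding_apply z hz, Set.indicator_of_notMem, mul_zero]
      rintro ⟨y, hy, rfl⟩
      exact hx ⟨y, hy, rfl⟩
    · rw [Set.indicator_of_notMem hxR]

end Comp

/-- The weighted composition with an `L²`-function does not depend on the choice of the density. -/
theorem weightedComp_eq_of_deriv {Φ' : X → ℝ} (h : IsBranch μ D σ Φ c)
    (h' : IsBranch μ D σ Φ' c) (ξ : Lp ℂ 2 μ) :
    weightedComp (σ '' D) Φ c ξ =ᵐ[μ] weightedComp (σ '' D) Φ' c ξ := by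
  -- For general `μ` the density need not be a.e. unique. But `ξ` vanishes a.e. outside a set `F` on
  -- which `μ` is σ-finite, and equal integrals force equal densities on `D ∩ F`.
  obtain ⟨F, hF, hξF, hσF⟩ := ((Lp.memLp ξ).aefinStronglyMeasurable two_ne_zero
    ENNReal.ofNat_ne_top).exists_set_sigmaFinite
  have hDF : (fun x => ENNReal.ofReal (Φ x)) =ᵐ[(μ.restrict F).restrict D]
      fun x => ENNReal.ofReal (Φ' x) := by
    refine ae_eq_of_forall_setLIntegral_eq_of_sigmaFinite h.measurable_deriv.ennreal_ofReal
      h'.measurable_deriv.ennreal_ofReal fun A hA _ => ?_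
    rw [Measure.restrict_restrict h.measurableSet_dom,
      Measure.restrict_restrict hA]
    have hm : MeasurableSet (A ∩ (D ∩ F)) := hA.inter (h.measurableSet_dom.inter hF)
    have hs : A ∩ (D ∩ F) ⊆ D := fun x hx => hx.2.1
    rw [← h.measure_image _ hs hm, h'.measure_image _ hs hm]
  rw [Measure.restrict_restrict h.measurableSet_dom] at hDF
  have key : ∀ᵐ x ∂μ, x ∈ D → ((Φ x ^ (-(1 / 2) : ℝ) : ℝ) : ℂ) * ξ x =
      ((Φ' x ^ (-(1 / 2) : ℝ) : ℝ) : ℂ) * ξ x := by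
    filter_upwards [(ae_restrict_iff' (h.measurableSet_dom.inter hF)).1 hDF,
      (ae_restrict_iff' hF.compl).1 hξF, h.pos, h'.pos] with x h1 h2 h3 h4 hx
    by_cases hxF : x ∈ F
    · have := h1 ⟨hx, hxF⟩
      rw [ENNReal.ofReal_eq_ofReal_iff (h3 hx).le (h4 hx).le] at this
      rw [this]
    · rw [h2 hxF, Pi.zero_apply, mul_zero, mul_zero]
  filter_upwards [h.ae_coding key] with x hx
  by_cases hxR : x ∈ σ '' D
  · simp only [weightedComp, Set.indicator_of_mem hxR]
    exact hx hxR
  · simp only [weightedComp, Set.indicator_of_notMem hxR]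

theorem congr {σ' : X → X} (h : IsBranch μ D σ Φ c) (hσ : Set.EqOn σ σ' D) :
    IsBranch μ D σ' Φ c where
  measurableSet_dom := h.measurableSet_dom
  measurable_map := by
    rw [← Set.domRestrict_eq_domRestrict_iff.2 hσ]; exact h.measurable_map
  measurable_deriv := h.measurable_deriv
  measurableSet_image A hA hAm := by
    rw [← (hσ.mono hA).image_eq]; exact h.measurableSet_image A hA hAm
  measure_image A hA hAm := by
    rw [← (hσ.mono hA).image_eq]; exact h.measure_image A hA hAm
  pos := h.pos
  measurable_coding := h.measurable_coding
  coding_apply y hy := by rw [← hσ hy]; exact h.coding_apply y hy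

theorem operator_mul_comm {D₁ D₂ E : Set X} {σ₁ σ₂ ρ₁ ρ₂ c₁ c₂ e₁ e₂ : X → X}
    {Φ₁ Φ₂ Ψ₁ Ψ₂ : X → ℝ} {S₁ S₂ T₁ T₂ : Lp ℂ 2 μ →L[ℂ] Lp ℂ 2 μ}
    (h₁ : IsBranch μ D₁ σ₁ Φ₁ c₁) (h₁' : IsBranch μ E ρ₁ Ψ₁ e₁) (hD₁ : ρ₁ '' E ⊆ D₁)
    (h₂ : IsBranch μ D₂ σ₂ Φ₂ c₂) (h₂' : IsBranch μ E ρ₂ Ψ₂ e₂) (hD₂ : ρ₂ '' E ⊆ D₂)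
    (hS₁ : ∀ ξ : Lp ℂ 2 μ, (S₁ ξ : X → ℂ) =ᵐ[μ] weightedComp (σ₁ '' D₁) Φ₁ c₁ ξ)
    (hT₁ : ∀ ξ : Lp ℂ 2 μ, (T₁ ξ : X → ℂ) =ᵐ[μ] weightedComp (ρ₁ '' E) Ψ₁ e₁ ξ)
    (hS₂ : ∀ ξ : Lp ℂ 2 μ, (S₂ ξ : X → ℂ) =ᵐ[μ] weightedComp (σ₂ '' D₂) Φ₂ c₂ ξ)
    (hT₂ : ∀ ξ : Lp ℂ 2 μ, (T₂ ξ : X → ℂ) =ᵐ[μ] weightedComp (ρ₂ '' E) Ψ₂ e₂ ξ)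
    (hσ : Set.EqOn (σ₁ ∘ ρ₁) (σ₂ ∘ ρ₂) E) (hc : e₁ ∘ c₁ = e₂ ∘ c₂) :
    S₁ * T₁ = S₂ * T₂ := by
  ext1 ξ
  refine Lp.ext ((h₁.operator_mul h₁' hD₁ hS₁ hT₁ ξ).trans
    (Filter.EventuallyEq.trans ?_ (h₂.operator_mul h₂' hD₂ hS₂ hT₂ ξ).symm))
  have := (h₁.comp h₁' hD₁).congr hσ
  rw [hσ.image_eq]
  rw [hc] at this ⊢
  exact this.weightedComp_eq_of_deriv (h₂.comp h₂' hD₂) ξ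

end IsBranch

end Branch

/-! ### Representations of `C*(Λ)` and its generation by edges. -/

namespace HigherRankGraph

variable {k : ℕ} {Λ : Type u} [Category.{v} Λ] {G : HigherRankGraph k Λ}

open Classical in
/-- The extension by the value `x₀` of a family indexed by edges to all paths. -/
noncomputable def edgeExt (G : HigherRankGraph k Λ) {α : Type*} (x₀ : α) (F : ∀ i, G.Edge i → α)
    (l : Arrow Λ) : α :=
  if h : ∃ i, G.deg l = basisVec i then F h.choose ⟨l, h.choose_spec⟩ else x₀

theorem edgeExt_eq {α : Type*} (x₀ : α) (F : ∀ i, G.Edge i → α) {i : Fin k} {l : Arrow Λ}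
    (h : G.deg l = basisVec i) : G.edgeExt x₀ F l = F i ⟨l, h⟩ := by
  have h' : ∃ i, G.deg l = basisVec i := ⟨i, h⟩
  rw [edgeExt, dif_pos h']
  -- An edge has only one colour, so the chosen colour is `i`.
  have hi : h'.choose = i := basisVec_injective (h'.choose_spec.symm.trans h)
  generalize_proofs _ hp
  generalize h'.choose = j at *
  subst hi
  rfl

section Representation

variable {A : Type w} [NonUnitalCStarAlgebra A]

/-- The representation of `C*(Λ)` on `A` given by a Cuntz–Krieger family in `A`. -/
noncomputable def liftCK (G : HigherRankGraph k Λ) {t : Arrow Λ → A} (ht : G.IsCKFamily t) :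
    CStarAlg.{u, v, w} G →⋆ₙₐ[ℂ] A where
  toFun x := (x : lp (fun P : CKPair.{u, v, w} G => P.alg) ∞) ⟨A, t, ht⟩
  map_smul' _ _ := rfl
  map_zero' := rfl
  map_add' _ _ := rfl
  map_mul' _ _ := rfl
  map_star' _ := rfl

theorem liftCK_gen {t : Arrow Λ → A} (ht : G.IsCKFamily t) (l : Arrow Λ) :
    liftCK G ht (G.gen l) = t l := rfl

theorem continuous_of_starAlgHom (π : CStarAlg.{u, v, w} G →⋆ₙₐ[ℂ] A) : Continuous π :=
  AddMonoidHomClass.continuous_of_bound π 1 fun x => by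
    rw [one_mul]; exact NonUnitalStarAlgHom.norm_apply_le π x

theorem dense_adjoin_gen (G : HigherRankGraph k Λ) :
    Dense (NonUnitalStarAlgebra.adjoin ℂ (Set.range (gen.{u, v, w} G)) :
      Set (CStarAlg.{u, v, w} G)) := by
  intro x
  rw [closure_subtype]
  have h := NonUnitalStarAlgHom.map_adjoin
    (NonUnitalStarSubalgebraClass.subtype (cstarSubalgebra.{u, v, w} G))
    (Set.range (gen.{u, v, w} G))
  have h1 : (NonUnitalStarSubalgebraClass.subtype (cstarSubalgebra.{u, v, w} G)) ''
      Set.range (gen.{u, v, w} G) = Set.range (universalFamily.{u, v, w} G) := by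
    rw [← Set.range_comp]; rfl
  rw [h1] at h
  have h2 := SetLike.ext'_iff.1 h
  simp only [NonUnitalStarSubalgebra.coe_map] at h2
  have h3 : (x : lp (fun P : CKPair.{u, v, w} G => P.alg) ∞) ∈ closure
    (NonUnitalStarAlgebra.adjoin ℂ (Set.range (universalFamily.{u, v, w} G)) :
      Set (lp (fun P : CKPair.{u, v, w} G => P.alg) ∞)) := x.2
  rw [← h2] at h3
  exact h3

/-- The images of all generators lie in every *-subalgebra that contains those of the edges. -/
theorem IsCKFamily.mem_of_edge_mem {t : Arrow Λ → A} (ht : G.IsCKFamily t) (hfin : G.IsFinite)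
    (i₀ : Fin k) {B : NonUnitalStarSubalgebra ℂ A}
    (hB : ∀ i f, G.deg f = basisVec i → t f ∈ B) (l : Arrow Λ) : t l ∈ B := by
  induction l using path_induction G with
  | id a =>
    rw [ht.ck4 a (basisVec i₀), finsum_mem_eq_finite_toFinset_sum _ (hfin.pathsInto a _)]
    refine sum_mem fun f hf => ?_
    rw [Set.Finite.mem_toFinset] at hf
    exact mul_mem (hB _ f hf.2) (star_mem (hB _ f hf.2))
  | edge_comp i f m hf hm ih =>
    obtain ⟨b, c, f, rfl⟩ := exists_eq_mk f
    obtain ⟨a, b', m, rfl⟩ := exists_eq_mk m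
    obtain rfl : b' = b := hm
    rw [pathComp_mk, ← ht.ck2]
    exact mul_mem (hB i _ hf) ih

theorem isCKFamily_gen (hfin : G.IsFinite) : G.IsCKFamily (gen.{u, v, w} G) where
  partialIsometry f := Subtype.ext <| lp.ext <| funext fun P => P.isCK.partialIsometry f
  ck1_proj a :=
    { isIdempotentElem := Subtype.ext <| lp.ext <| funext fun P =>
        (P.isCK.ck1_proj a).isIdempotentElem.eq
      isSelfAdjoint := Subtype.ext <| lp.ext <| funext fun P =>
        (P.isCK.ck1_proj a).isSelfAdjoint.star_eq }
  ck1_orth a b hab := Subtype.ext <| lp.ext <| funext fun P => P.isCK.ck1_orth a b hab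
  ck2 g f := Subtype.ext <| lp.ext <| funext fun P => P.isCK.ck2 g f
  ck3 f := Subtype.ext <| lp.ext <| funext fun P => P.isCK.ck3 f
  ck4 a n := by
    rw [finsum_mem_eq_finite_toFinset_sum _ (hfin.pathsInto a n)]
    refine Subtype.ext <| lp.ext <| funext fun P => ?_
    have := P.isCK.ck4 a n
    rw [finsum_mem_eq_finite_toFinset_sum _ (hfin.pathsInto a n)] at this
    rw [AddSubmonoidClass.coe_finsetSum, lp.coeFn_sum, Finset.sum_apply]
    exact this

theorem adjoin_edges_eq_adjoin_gen (hfin : G.IsFinite) (i₀ : Fin k) :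
    NonUnitalStarAlgebra.adjoin ℂ {x | ∃ i, ∃ f : G.Edge i, x = gen.{u, v, w} G f.1} =
      NonUnitalStarAlgebra.adjoin ℂ (Set.range (gen.{u, v, w} G)) := by
  refine le_antisymm (NonUnitalStarAlgebra.adjoin_le ?_) (NonUnitalStarAlgebra.adjoin_le ?_)
  · rintro _ ⟨i, f, rfl⟩
    exact NonUnitalStarAlgebra.subset_adjoin ℂ _ (Set.mem_range_self f.1)
  · rintro _ ⟨l, rfl⟩
    refine (isCKFamily_gen hfin).mem_of_edge_mem hfin i₀ (fun i f hf => ?_) l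
    apply NonUnitalStarAlgebra.subset_adjoin
    exact ⟨i, ⟨f, hf⟩, rfl⟩

theorem dense_adjoin_edges (hfin : G.IsFinite) (i₀ : Fin k) :
    Dense (NonUnitalStarAlgebra.adjoin ℂ {x | ∃ i, ∃ f : G.Edge i, x = gen.{u, v, w} G f.1} :
      Set (CStarAlg.{u, v, w} G)) := by
  rw [adjoin_edges_eq_adjoin_gen hfin i₀]
  exact dense_adjoin_gen G

/-- *-homomorphisms between C*-algebras are contractive, so agreement on the dense *-subalgebra
generated by the edges suffices. -/
theorem starAlgHom_ext (hfin : G.IsFinite) (i₀ : Fin k)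
    {π π' : CStarAlg.{u, v, w} G →⋆ₙₐ[ℂ] A}
    (h : ∀ i (f : G.Edge i), π (G.gen f.1) = π' (G.gen f.1)) : π = π' := by
  refine DFunLike.coe_injective (Continuous.ext_on (dense_adjoin_edges hfin i₀)
    (continuous_of_starAlgHom π) (continuous_of_starAlgHom π') ?_)
  have : NonUnitalStarAlgebra.adjoin ℂ {x | ∃ i, ∃ f : G.Edge i, x = gen.{u, v, w} G f.1} ≤
      NonUnitalStarAlgHom.equalizer π π' := by
    refine NonUnitalStarAlgebra.adjoin_le ?_
    rintro _ ⟨i, f, rfl⟩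
    exact h i f
  exact fun x hx => this hx

theorem closure_range_starAlgHom (hfin : G.IsFinite) (i₀ : Fin k)
    (π : CStarAlg.{u, v, w} G →⋆ₙₐ[ℂ] A) {S : ∀ i, G.Edge i → A}
    (h : ∀ i (f : G.Edge i), π (G.gen f.1) = S i f) :
    closure (Set.range π) =
      closure (NonUnitalStarAlgebra.adjoin ℂ {T | ∃ i f, T = S i f} : Set A) := by
  have h1 := NonUnitalStarAlgHom.map_adjoin π
    {x | ∃ i, ∃ f : G.Edge i, x = gen.{u, v, w} G f.1}
  have h2 : π '' {x | ∃ i, ∃ f : G.Edge i, x = gen.{u, v, w} G f.1} = {T | ∃ i f, T = S i f} := by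
    ext T
    constructor
    · rintro ⟨_, ⟨i, f, rfl⟩, rfl⟩
      exact ⟨i, f, h i f⟩
    · rintro ⟨i, f, rfl⟩
      exact ⟨_, ⟨i, f, rfl⟩, h i f⟩
  rw [h2] at h1
  rw [← h1, NonUnitalStarSubalgebra.coe_map]
  refine subset_antisymm (closure_minimal ?_ isClosed_closure)
    (closure_mono (Set.image_subset_range _ _))
  exact (continuous_of_starAlgHom π).range_subset_closure_image_dense (dense_adjoin_edges hfin i₀)

end Representation

end HigherRankGraph

/-! ### The operators of a semibranching system satisfy the edge relations. -/

namespace IsEdgeSemibranching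

open HigherRankGraph

variable {k : ℕ} {Λ : Type u} [Category.{v} Λ] {G : HigherRankGraph k Λ}
  {X : Type w} [MeasurableSpace X] {μ : Measure X}
  {D : ∀ i, G.Edge i → Set X} {τ : ∀ i, G.Edge i → X → X} {Φ : ∀ i, G.Edge i → X → ℝ}
  {c : Fin k → X → X} {DV : Λ → Set X}

theorem isBranch (h : IsEdgeSemibranching G μ D τ Φ c DV) (i : Fin k) (f : G.Edge i) :
    IsBranch μ (D i f) (τ i f) (Φ i f) (c i) where
  measurableSet_dom := (h.semibranching i).measurableSet_dom f
  measurable_map := (h.semibranching i).measurable_map f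
  measurable_deriv := ((h.semibranching i).rnDeriv f).measurable
  measurableSet_image := ((h.semibranching i).rnDeriv f).measurableSet_image
  measure_image := ((h.semibranching i).rnDeriv f).measure_image
  pos := (h.semibranching i).rnDeriv_pos f
  measurable_coding := (h.coding i).measurable
  coding_apply := (h.coding i).apply_map f

theorem square (h : IsEdgeSemibranching G μ D τ Φ c DV) {i j : Fin k} {l m n b : Arrow Λ}
    (hl : G.deg l = basisVec i) (hm : G.deg m = basisVec j) (hn : G.deg n = basisVec j)
    (hb : G.deg b = basisVec i) (hml : m.right = l.left) (hbn : b.right = n.left)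
    (hc : pathComp l m = pathComp n b) :
    τ j ⟨m, hm⟩ '' D j ⟨m, hm⟩ ⊆ D i ⟨l, hl⟩ ∧ τ i ⟨b, hb⟩ '' D i ⟨b, hb⟩ ⊆ D j ⟨n, hn⟩ ∧
      D j ⟨m, hm⟩ = D i ⟨b, hb⟩ ∧
      Set.EqOn (τ i ⟨l, hl⟩ ∘ τ j ⟨m, hm⟩) (τ j ⟨n, hn⟩ ∘ τ i ⟨b, hb⟩) (D j ⟨m, hm⟩) := by
  have hL := congrArg (fun x => x.left) hc
  have hR := congrArg (fun x => x.right) hc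
  simp only [pathComp_left hml, pathComp_left hbn, pathComp_right hml, pathComp_right hbn]
    at hL hR
  obtain ⟨x, d, l, rfl⟩ := exists_eq_mk l
  obtain ⟨a, x', m, rfl⟩ := exists_eq_mk m
  obtain ⟨y, d', n, rfl⟩ := exists_eq_mk n
  obtain ⟨a', y', b, rfl⟩ := exists_eq_mk b
  obtain rfl : x' = x := hml
  obtain rfl : y' = y := hbn
  obtain rfl : a = a' := hL
  obtain rfl : d = d' := hR
  rw [pathComp_mk, pathComp_mk, Arrow.mk_inj] at hc
  obtain ⟨h1, h2, h3⟩ := h.cond_iii i j l m n b hl hm hn hb hc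
  exact ⟨h1, h2, by rw [h.cond_i_dom, h.cond_i_dom]; rfl, h3⟩

/-- Every composable pair `f g` is one side of a commuting square, obtained by refactoring it with
the degrees exchanged; condition (iii) then applies. -/
theorem range_subset (h : IsEdgeSemibranching G μ D τ Φ c DV) {i j : Fin k} {f g : Arrow Λ}
    (hf : G.deg f = basisVec i) (hg : G.deg g = basisVec j) (hgf : g.right = f.left) :
    τ j ⟨g, hg⟩ '' D j ⟨g, hg⟩ ⊆ D i ⟨f, hf⟩ := by
  obtain ⟨n, b, hbn, hc, hn, hb⟩ := G.exists_pathComp (l := pathComp f g) (m := basisVec j)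
    (n := basisVec i) (by rw [G.deg_pathComp hgf, hf, hg, add_comm])
  exact (h.square hf hg hn hb hgf hbn hc.symm).1

/-- The ranges lie in `D_f` exactly, by `range_subset`; they exhaust it up to a null set, by (v). -/
theorem dom_ae_eq (h : IsEdgeSemibranching G μ D τ Φ c DV) (hfin : G.IsFinite) {i : Fin k}
    (j : Fin k) {f : Arrow Λ} (hf : G.deg f = basisVec i) :
    D i ⟨f, hf⟩ =ᵐ[μ] ⋃ g ∈ (hfin.pathsInto f.left (basisVec j)).toFinset,
      G.edgeExt ∅ (fun i f => τ i f '' D i f) g := by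
  refine (ae_le_set.2 (measure_mono_null ?_ (h.cond_v f.left j))).antisymm
    (Filter.Eventually.of_forall (Set.iUnion₂_subset fun g hg => ?_))
  · rw [h.cond_i_dom]
    refine Set.sdiff_subset_sdiff_right (Set.iUnion_subset fun g => ?_)
    obtain ⟨⟨g, hg⟩, hgf⟩ := g
    refine subset_trans ?_ (Set.subset_biUnion_of_mem
      ((hfin.pathsInto f.left (basisVec j)).mem_toFinset.2 ⟨hgf, hg⟩))
    rw [edgeExt_eq _ _ hg]
  · rw [Set.Finite.mem_toFinset] at hg
    rw [edgeExt_eq _ _ hg.2]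
    exact h.range_subset hf hg.2 hg.1

theorem isEdgeFamily (h : IsEdgeSemibranching G μ D τ Φ c DV) (hfin : G.IsFinite)
    {S : ∀ i, G.Edge i → (Lp ℂ 2 μ →L[ℂ] Lp ℂ 2 μ)}
    (hS : ∀ i f (ξ : Lp ℂ 2 μ),
      (S i f ξ : X → ℂ) =ᵐ[μ] weightedComp (τ i f '' D i f) (Φ i f) (c i) ξ) :
    IsEdgeFamily hfin (G.edgeExt 0 S) where
  partialIsometry i f hf := by
    rw [edgeExt_eq _ _ hf]
    exact (h.isBranch i _).mul_star_mul_self (hS i _)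
  star_mul_self i j f hf := by
    have hm : ∀ g ∈ (hfin.pathsInto f.left (basisVec j)).toFinset,
        MeasurableSet (G.edgeExt ∅ (fun i f => τ i f '' D i f) g) := fun g hg => by
      rw [Set.Finite.mem_toFinset] at hg
      rw [edgeExt_eq _ _ hg.2]
      exact (h.isBranch j _).measurableSet_range
    rw [edgeExt_eq _ _ hf, (h.isBranch i _).star_mul_self (hS i _),
      indicatorMul_congr (h.isBranch i _).measurableSet_dom (Finset.measurableSet_biUnion _ hm)
        (h.dom_ae_eq hfin j hf), indicatorMul_biUnion _ hm]
    · refine Finset.sum_congr rfl fun g hg => ?_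
      rw [Set.Finite.mem_toFinset] at hg
      rw [edgeExt_eq _ _ hg.2, edgeExt_eq _ _ hg.2, (h.isBranch j _).mul_star_self (hS j _)]
    · intro g hg g' hg' hne
      rw [Set.Finite.mem_toFinset] at hg hg'
      rw [edgeExt_eq _ _ hg.2, edgeExt_eq _ _ hg'.2]
      exact (h.semibranching j).disjoint _ _ fun e => hne (congrArg Subtype.val e)
  star_mul_of_ne i f g hf hg hne := by
    have hf' := h.isBranch i ⟨f, hf⟩
    have hg' := h.isBranch i ⟨g, hg⟩
    rw [edgeExt_eq _ _ hf, edgeExt_eq _ _ hg, ← hf'.indicatorMul_mul_operator (hS i _),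
      ← hg'.indicatorMul_mul_operator (hS i _), star_mul,
      (isStarProjection_indicatorMul hf'.measurableSet_range).isSelfAdjoint.star_eq,
      mul_assoc, ← mul_assoc (indicatorMul μ _),
      indicatorMul_mul hf'.measurableSet_range hg'.measurableSet_range,
      indicatorMul_congr (hf'.measurableSet_range.inter hg'.measurableSet_range)
        MeasurableSet.empty (ae_eq_empty.2 ((h.semibranching i).disjoint _ _
          fun e => hne (congrArg Subtype.val e))),
      indicatorMul_empty, zero_mul, mul_zero]
  commute i j f g g' f' hf hg hg' hf' hgf hfg hc := by
    obtain ⟨h1, h2, h3, h4⟩ := h.square hf hg hg' hf' hgf hfg hc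
    rw [edgeExt_eq _ _ hf, edgeExt_eq _ _ hg, edgeExt_eq _ _ hg', edgeExt_eq _ _ hf']
    have hb := h.isBranch j ⟨g, hg⟩
    have hT := hS j ⟨g, hg⟩
    -- By (i) the two inner branches have the same domain, as `g` and `f'` share their source.
    rw [h3] at h1 h4 hb hT
    exact (h.isBranch i ⟨f, hf⟩).operator_mul_comm hb h1 (h.isBranch j ⟨g', hg'⟩)
      (h.isBranch i ⟨f', hf'⟩) h2 (hS i _) hT (hS j _) (hS i _) h4 (h.cond_iv j i)

end IsEdgeSemibranching

theorem mainTheorem10 {k : ℕ} (hk : 1 ≤ k) {Λ : Type u} [Category.{v} Λ]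
    (G : HigherRankGraph k Λ) (hfin : G.IsFinite) (hns : G.NoSources)
    {X : Type w} [MeasurableSpace X] (μ : Measure X)
    (D : ∀ i, G.Edge i → Set X) (τ : ∀ i, G.Edge i → X → X) (Φ : ∀ i, G.Edge i → X → ℝ)
    (c : Fin k → X → X) (DV : Λ → Set X)
    (hsys : IsEdgeSemibranching G μ D τ Φ c DV) :
    ∃ S : ∀ i, G.Edge i → (Lp ℂ 2 μ →L[ℂ] Lp ℂ 2 μ),
      (∀ (i : Fin k) (f : G.Edge i) (ξ : Lp ℂ 2 μ),
        (S i f ξ : X → ℂ) =ᵐ[μ] (τ i f '' D i f).indicator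
          (fun x => ((Φ i f (c i x) ^ (-(1 / 2) : ℝ) : ℝ) : ℂ) * ξ (c i x))) ∧
      ∃ π : HigherRankGraph.CStarAlg.{u, v, w} G →⋆ₙₐ[ℂ] (Lp ℂ 2 μ →L[ℂ] Lp ℂ 2 μ),
        (∀ (i : Fin k) (f : G.Edge i), π (G.gen f.1) = S i f) ∧
        (∀ π' : HigherRankGraph.CStarAlg.{u, v, w} G →⋆ₙₐ[ℂ] (Lp ℂ 2 μ →L[ℂ] Lp ℂ 2 μ),
          (∀ (i : Fin k) (f : G.Edge i), π' (G.gen f.1) = S i f) → π' = π) ∧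
        closure (Set.range π) =
          closure (NonUnitalStarAlgebra.adjoin ℂ {T | ∃ i f, T = S i f} :
            Set (Lp ℂ 2 μ →L[ℂ] Lp ℂ 2 μ)) := by
  choose S hS using fun i f => (hsys.isBranch i f).exists_operator
  have hE := hsys.isEdgeFamily hfin hS
  -- Some colour is needed to define the vertex projections from edges; this uses `k ≥ 1`.
  have i₀ : Fin k := ⟨0, hk⟩
  have hπ : ∀ i (f : G.Edge i), G.liftCK (hE.isCKFamily i₀) (G.gen f.1) = S i f := fun i f => by
    rw [HigherRankGraph.liftCK_gen, hE.pathFamily_edge f.2, HigherRankGraph.edgeExt_eq _ _ f.2]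
  exact ⟨S, hS, G.liftCK (hE.isCKFamily i₀), hπ,
    fun π' h => HigherRankGraph.starAlgHom_ext hfin i₀ fun i f => (h i f).trans (hπ i f).symm,
    HigherRankGraph.closure_range_starAlgHom hfin i₀ _ hπ⟩
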